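/- Let $R$ and $S$ be associative rings with unit; modules are unitary left modules unless said otherwise, and right modules are left modules over the opposite ring. A module is *super finitely presented* if it has a projective resolution by finitely generated projective modules. Let $C={}_SC_R$ be a *faithfully semidualizing* bimodule, i.e. an $(S,R)$-bimodule such that: ${}_SC$ and $C_R$ are super finitely presented; the homothety maps $S\to\operatorname{Hom}_{R^{op}}(C,C)$ and $R\to\operatorname{Hom}_S(C,C)$ are bijective; $\operatorname{Ext}^i_S(C,C)=0=\operatorname{Ext}^i_{R^{op}}(C,C)$ for all $i\ge1$; and, for every left $S$-module $N$ and right $R$-module $M$, $\operatorname{Hom}_S(C,N)=0$ implies $N=0$ and $\operatorname{Hom}_{R^{op}}(C,M)=0$ implies $M=0$. The *Bass class* $\mathcal B_C(S)$ consists of the left $S$-modules $N$ with $\operatorname{Ext}^i_S(C,N)=0=\operatorname{Tor}^R_i(C,\operatorname{Hom}_S(C,N))$ for all $i\ge1$ and for which the evaluation map $C\otimes_R\operatorname{Hom}_S(C,N)\to N$ is an isomorphism. For an integer $n\ge0$ consider the following classes of left $S$-modules. - $\mathcal I(S)_{\le n}$: modules of injective dimension at most $n$. - $\mathcal{FI}(S)_{\le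 n}$ (resp. $\mathcal{WI}(S)_{\le n}$): modules $M$ of FP-injective (resp. weak injective) dimension at most $n$, i.e. for some $m\le n$ one has $\operatorname{Ext}_S^{m+1}(F,M)=0$ for all finitely presented (resp. super finitely presented) left $S$-modules $F$. - $\mathcal P_C(S)_{\le n}$ (resp. $\mathcal F_C(S)_{\le n}$, $\mathcal{WF}_C(S)_{\le n}$): modules $M$ for which there is an exact sequence $0\to C\otimes_RQ_n\to\cdots\to C\otimes_RQ_0\to M\to0$ of left $S$-modules with all $Q_i$ projective (resp. flat, weak flat) left $R$-modules; here $Q$ is *weak flat* if $\operatorname{Tor}_1^R(X,Q)=0$ for every super finitely presented right $R$-module $X$. For every integer $n\ge0$ and every left $S$-module $N$, the following are equivalent: 1. $N\in\mathcal B_C(S)$. 2. There is an exact sequence $\cdots\to V_1\to V_0\to V_{-1}\to\cdots$ of left $S$-modules which stays exact under $\operatorname{Hom}_S(C,-)$, with each $V_i$ in $\mathcal I(S)_{\le n}$ or in $\mathcal P_C(S)_{\le n}$, such that $N\cong\operatorname{coker}(V_1\to V_0)$. 3. The same with each $V_i$ in $\mathcal I(S)_{\le n}$ or in $\mathcal F_C(S)_{\le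 n}$. 4. The same with each $V_i$ in $\mathcal{FI}(S)_{\le n}$ or in $\mathcal F_C(S)_{\le n}$. 5. The same with each $V_i$ in $\mathcal{WI}(S)_{\le n}$ or in $\mathcal{WF}_C(S)_{\le n}$. -/

import Mathlib

open CategoryTheory TensorProduct

universe u

noncomputable section

namespace Foxby

/-! Throughout, a right `R`-module is a module over `Rᵐᵒᵖ`, and an `(S, R)`-bimodule is an additive
group `X` with commuting structures `Module S X` and `Module Rᵐᵒᵖ X`; the element `x * r` is
`MulOpposite.op r • x`.  A right `R`-module is, in a unique way, a `(ℤ, R)`-bimodule. -/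

section Tensor

set_option linter.unusedSectionVars false

variable (S R X M : Type*) [Ring S] [Ring R] [AddCommGroup X] [Module S X] [Module Rᵐᵒᵖ X]
  [SMulCommClass S Rᵐᵒᵖ X] [AddCommGroup M] [Module R M]

/-- The relations `(x r) ⊗ m = x ⊗ (r m)` in `X ⊗_ℤ M`.  The set of generators is stable
under `S`, so that the `S`-submodule generated by it is the subgroup generated by it. -/
def balancedRel : Submodule S (X ⊗[ℤ] M) :=
  Submodule.span S {t | ∃ (x : X) (r : R) (m : M),
    t = (MulOpposite.op r • x) ⊗ₜ[ℤ] m - x ⊗ₜ[ℤ] (r • m)}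

/-- The tensor product `X ⊗_R M` of an `(S, R)`-bimodule `X` and a left `R`-module `M` over the
(not necessarily commutative) ring `R`, as a left `S`-module. -/
abbrev BTensor : Type _ := (X ⊗[ℤ] M) ⧸ balancedRel S R X M

variable {X M}

/-- The pure tensor `x ⊗ m` in `X ⊗_R M`. -/
def BTensor.tmul (x : X) (m : M) : BTensor S R X M :=
  (balancedRel S R X M).mkQ (x ⊗ₜ[ℤ] m)

theorem BTensor.smul_tmul (x : X) (r : R) (m : M) :
    BTensor.tmul S R (MulOpposite.op r • x) m = BTensor.tmul S R x (r • m) := by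
  refine (Submodule.Quotient.eq _).2 (Submodule.subset_span ⟨x, r, m, rfl⟩)

variable {S R}

/-- The `S`-linear map `X ⊗_R M → P` induced by an `R`-balanced map `X × M → P` which is
`S`-linear in the first and additive in the second variable. -/
def BTensor.lift {P : Type*} [AddCommGroup P] [Module S P] (f : X →ₗ[S] M →ₗ[ℤ] P)
    (hf : ∀ (x : X) (r : R) (m : M), f (MulOpposite.op r • x) m = f x (r • m)) :
    BTensor S R X M →ₗ[S] P :=
  (balancedRel S R X M).liftQ (TensorProduct.AlgebraTensorModule.lift f) (by
    refine Submodule.span_le.2 ?_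
    rintro _ ⟨x, r, m, rfl⟩
    simp [hf])

@[simp] theorem BTensor.lift_tmul {P : Type*} [AddCommGroup P] [Module S P]
    (f : X →ₗ[S] M →ₗ[ℤ] P)
    (hf : ∀ (x : X) (r : R) (m : M), f (MulOpposite.op r • x) m = f x (r • m)) (x : X) (m : M) :
    BTensor.lift f hf (BTensor.tmul S R x m) = f x m := rfl

theorem BTensor.hom_ext {P : Type*} [AddCommGroup P] [Module S P] {f g : BTensor S R X M →ₗ[S] P}
    (h : ∀ (x : X) (m : M), f (BTensor.tmul S R x m) = g (BTensor.tmul S R x m)) : f = g := by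
  refine Submodule.linearMap_qext _ (TensorProduct.AlgebraTensorModule.ext fun x m => h x m)

/-- The canonical map `X × M → X ⊗_R M`. -/
def BTensor.mk : X →ₗ[S] M →ₗ[ℤ] BTensor S R X M where
  toFun x :=
    { toFun := fun m => BTensor.tmul S R x m
      map_add' := fun m m' => by simp [BTensor.tmul, TensorProduct.tmul_add]
      map_smul' := fun k m => by
        rw [BTensor.tmul, TensorProduct.tmul_smul, map_zsmul]; simp [BTensor.tmul] }
  map_add' x x' := by ext m; simp [BTensor.tmul, TensorProduct.add_tmul]
  map_smul' s x := by
    ext m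
    change (balancedRel S R X M).mkQ ((s • x) ⊗ₜ[ℤ] m) = s • (balancedRel S R X M).mkQ (x ⊗ₜ[ℤ] m)
    rw [← map_smul, TensorProduct.smul_tmul']

@[simp] theorem BTensor.mk_apply (x : X) (m : M) :
    BTensor.mk (S := S) (R := R) x m = BTensor.tmul S R x m := rfl

variable (S X) in
/-- `X ⊗_R g : X ⊗_R M → X ⊗_R M'` for an `R`-linear map `g : M → M'`. -/
def BTensor.lTensor {M' : Type*} [AddCommGroup M'] [Module R M'] (g : M →ₗ[R] M') :
    BTensor S R X M →ₗ[S] BTensor S R X M' :=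
  BTensor.lift
    { toFun := fun x => (BTensor.mk x).comp (g.restrictScalars ℤ)
      map_add' := fun x x' => by ext m; simp
      map_smul' := fun s x => by ext m; simp }
    (fun x r m => by simp [BTensor.smul_tmul])

@[simp] theorem BTensor.lTensor_tmul {M' : Type*} [AddCommGroup M'] [Module R M'] (g : M →ₗ[R] M')
    (x : X) (m : M) :
    BTensor.lTensor S X g (BTensor.tmul S R x m) = BTensor.tmul S R x (g m) := rfl

end Tensor

/-- `f ⊗_R M : X ⊗_R M → Y ⊗_R M` for a map `f : X → Y` of right `R`-modules. -/
def BTensor.rTensor {R X Y : Type*} (M : Type*) [Ring R] [AddCommGroup X] [Module Rᵐᵒᵖ X]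
    [AddCommGroup Y] [Module Rᵐᵒᵖ Y] [AddCommGroup M] [Module R M] (f : X →ₗ[Rᵐᵒᵖ] Y) :
    BTensor ℤ R X M →ₗ[ℤ] BTensor ℤ R Y M :=
  BTensor.lift (BTensor.mk.comp (f.restrictScalars ℤ))
    (fun x r m => by simp [BTensor.smul_tmul])

section Functors

variable (S R : Type*) [Ring S] [Ring R] (X : Type u) [AddCommGroup X] [Module S X]
  [Module Rᵐᵒᵖ X] [SMulCommClass S Rᵐᵒᵖ X]

/-- The functor `X ⊗_R -` from left `R`-modules to left `S`-modules. -/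
def tensorFunctor : ModuleCat.{u} R ⥤ ModuleCat.{u} S where
  obj M := ModuleCat.of S (BTensor S R X M)
  map g := ModuleCat.ofHom (BTensor.lTensor S X g.hom)
  map_id M := by
    ext1
    exact BTensor.hom_ext fun x m => rfl
  map_comp f g := by
    ext1
    exact BTensor.hom_ext fun x m => rfl

instance : (tensorFunctor S R X).Additive where
  map_add {M M'} {f g} := by
    ext1
    refine BTensor.hom_ext fun x m => ?_
    change BTensor.tmul S R x (f.hom m + g.hom m)
      = BTensor.tmul S R x (f.hom m) + BTensor.tmul S R x (g.hom m)
    exact map_add (BTensor.mk (S := S) (R := R) x) _ _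

end Functors

/-- `Tor_i^R(X, M)` for an `(S, R)`-bimodule `X` (with `S = ℤ` for a right `R`-module) and a left
`R`-module `M`: the value at `M` of the `i`-th left derived functor of `X ⊗_R -`. -/
def Tor (S : Type*) {R : Type u} [Ring S] [Ring R] (X : Type u) [AddCommGroup X] [Module S X]
    [Module Rᵐᵒᵖ X] [SMulCommClass S Rᵐᵒᵖ X] (i : ℕ) (M : ModuleCat.{u} R) : ModuleCat.{u} S :=
  ((tensorFunctor S R X).leftDerived i).obj M

section Hom

variable (R S C N : Type*) [Ring R] [Ring S] [AddCommGroup C] [Module S C] [Module Rᵐᵒᵖ C]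
  [SMulCommClass S Rᵐᵒᵖ C] [AddCommGroup N] [Module S N]

/-- `Hom_S(C, N)` for an `(S, R)`-bimodule `C`, with its left `R`-module structure
`(r f)(c) = f (c r)`. -/
def BHom (_R S C N : Type*) [Ring S] [AddCommGroup C] [Module S C] [AddCommGroup N] [Module S N] :
    Type _ :=
  C →ₗ[S] N

instance : AddCommGroup (BHom R S C N) := inferInstanceAs (AddCommGroup (C →ₗ[S] N))

/-- Right multiplication `c ↦ c r`, as an `S`-linear map. -/
def rightMul {R : Type*} [Ring R] [Module Rᵐᵒᵖ C] [SMulCommClass S Rᵐᵒᵖ C] (r : R) : C →ₗ[S] C where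
  toFun c := MulOpposite.op r • c
  map_add' c c' := smul_add _ c c'
  map_smul' s c := (smul_comm s (MulOpposite.op r) c).symm

/-- Left multiplication `c ↦ s c`, as a map of right `R`-modules. -/
def leftMul {S : Type*} [Ring S] [Module S C] [SMulCommClass S Rᵐᵒᵖ C] (s : S) : C →ₗ[Rᵐᵒᵖ] C where
  toFun c := s • c
  map_add' c c' := smul_add s c c'
  map_smul' r c := smul_comm s r c

instance : Module R (BHom R S C N) where
  smul r f := LinearMap.comp (show C →ₗ[S] N from f) (rightMul S C r)
  one_smul f := LinearMap.ext fun c => congrArg (show C →ₗ[S] N from f) (one_smul Rᵐᵒᵖ c)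
  mul_smul r r' f := LinearMap.ext fun c =>
    congrArg (show C →ₗ[S] N from f) (mul_smul (MulOpposite.op r') (MulOpposite.op r) c)
  smul_zero r := LinearMap.ext fun c => rfl
  smul_add r f g := LinearMap.ext fun c => rfl
  add_smul r r' f := LinearMap.ext fun c => by
    change (show C →ₗ[S] N from f) (MulOpposite.op (r + r') • c) =
      (show C →ₗ[S] N from f) (MulOpposite.op r • c) +
      (show C →ₗ[S] N from f) (MulOpposite.op r' • c)
    rw [← map_add, MulOpposite.op_add, add_smul]
  zero_smul f := LinearMap.ext fun c => by
    change (show C →ₗ[S] N from f) (MulOpposite.op (0 : R) • c) = 0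
    rw [MulOpposite.op_zero, zero_smul, map_zero]

/-- The evaluation map `ν_N : C ⊗_R Hom_S(C, N) → N`, `c ⊗ f ↦ f c`. -/
def evalMap : BTensor S R C (BHom R S C N) →ₗ[S] N :=
  BTensor.lift
    { toFun := fun c =>
        { toFun := fun f => (show C →ₗ[S] N from f) c
          map_add' := fun _ _ => rfl
          map_smul' := fun k f => LinearMap.smul_apply k (show C →ₗ[S] N from f) c }
      map_add' := fun c c' => LinearMap.ext fun f => map_add (show C →ₗ[S] N from f) c c'
      map_smul' := fun s c => LinearMap.ext fun f => map_smul (show C →ₗ[S] N from f) s c }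
    (fun _ _ _ => rfl)

end Hom

section ModuleClasses

variable {A : Type u} [Ring A]

/-- A module is super finitely presented if it has a projective resolution by finitely generated
projective modules. -/
def IsSuperFP (M : ModuleCat.{u} A) : Prop :=
  ∃ P : ProjectiveResolution M, ∀ i, Module.Finite A (P.complex.X i)

/-- Vanishing of `Ext^i_A(M, N)`. -/
def ExtVanish (M N : ModuleCat.{u} A) (i : ℕ) : Prop := Subsingleton (Abelian.Ext M N i)

/-- A left module `F` is flat if `- ⊗ F` preserves injectivity of maps of right modules. -/
def IsFlat (F : ModuleCat.{u} A) : Prop :=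
  ∀ (X Y : ModuleCat.{u} Aᵐᵒᵖ) (f : X →ₗ[Aᵐᵒᵖ] Y), Function.Injective f →
    Function.Injective (BTensor.rTensor F f)

/-- A left module `F` is weak flat if `Tor_1(X, F) = 0` for all super finitely presented right
modules `X`. -/
def IsWeakFlat (F : ModuleCat.{u} A) : Prop :=
  ∀ X : ModuleCat.{u} Aᵐᵒᵖ, IsSuperFP X → Subsingleton (Tor ℤ X 1 F)

/-- Injective dimension at most `n`. -/
def InjDimLE (n : ℕ) (M : ModuleCat.{u} A) : Prop := HasInjectiveDimensionLE M n

/-- FP-injective dimension at most `n`: the least `m` with `Ext^{m+1}(F, M) = 0` for all finitely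
presented `F` exists and is at most `n`. -/
def FPInjDimLE (n : ℕ) (M : ModuleCat.{u} A) : Prop :=
  ∃ m ≤ n, ∀ F : ModuleCat.{u} A, Module.FinitePresentation A F → ExtVanish F M (m + 1)

/-- Weak injective dimension at most `n`: the least `m` with `Ext^{m+1}(F, M) = 0` for all super
finitely presented `F` exists and is at most `n`. -/
def WeakInjDimLE (n : ℕ) (M : ModuleCat.{u} A) : Prop :=
  ∃ m ≤ n, ∀ F : ModuleCat.{u} A, IsSuperFP F → ExtVanish F M (m + 1)

/-- There is an exact sequence `0 → X_n → ⋯ → X_1 → X_0 → M → 0` with all `X_i` in the class `𝒳`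
(extended by `X_i = 0` for `i > n`). -/
def ResDimLE (𝒳 : ModuleCat.{u} A → Prop) (n : ℕ) (M : ModuleCat.{u} A) : Prop :=
  ∃ (X : ℕ → ModuleCat.{u} A) (d : ∀ i, X (i + 1) →ₗ[A] X i) (ε : X 0 →ₗ[A] M),
    (∀ i ≤ n, 𝒳 (X i)) ∧ (∀ i, n < i → Subsingleton (X i)) ∧
    (∀ i, Function.Exact (d (i + 1)) (d i)) ∧ Function.Exact (d 0) ε ∧ Function.Surjective ε

end ModuleClasses

section Bimodule

variable (R S : Type u) [Ring R] [Ring S] (C : Type u) [AddCommGroup C] [Module S C]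
  [Module Rᵐᵒᵖ C] [SMulCommClass S Rᵐᵒᵖ C]

/-- Semidualizing `(S, R)`-bimodules. -/
structure IsSemidualizing : Prop where
  superFP_left : IsSuperFP (ModuleCat.of S C)
  superFP_right : IsSuperFP (ModuleCat.of Rᵐᵒᵖ C)
  homothety_left : Function.Bijective (fun s : S => leftMul R C s)
  homothety_right : Function.Bijective (fun r : R => rightMul S C r)
  ext_left : ∀ i ≥ 1, ExtVanish (ModuleCat.of S C) (ModuleCat.of S C) i
  ext_right : ∀ i ≥ 1, ExtVanish (ModuleCat.of Rᵐᵒᵖ C) (ModuleCat.of Rᵐᵒᵖ C) i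

/-- Faithfully semidualizing `(S, R)`-bimodules. -/
structure IsFaithfullySemidualizing : Prop extends IsSemidualizing R S C where
  faithful_left : ∀ N : ModuleCat.{u} S, Subsingleton (C →ₗ[S] N) → Subsingleton N
  faithful_right : ∀ M : ModuleCat.{u} Rᵐᵒᵖ, Subsingleton (C →ₗ[Rᵐᵒᵖ] M) → Subsingleton M

variable {S}

/-- Membership of `N` in the Bass class `ℬ_C(S)`. -/
structure InBassClass (N : ModuleCat.{u} S) : Prop where
  ext_vanish : ∀ i ≥ 1, ExtVanish (ModuleCat.of S C) N i
  tor_vanish : ∀ i ≥ 1, Subsingleton (Tor S C i (ModuleCat.of R (BHom R S C N)))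
  eval_bijective : Function.Bijective (evalMap R S C N)

/-- `C`-projective modules: those of the form `C ⊗_R P` with `P` projective. -/
def IsCProjective (V : ModuleCat.{u} S) : Prop :=
  ∃ P : ModuleCat.{u} R, Module.Projective R P ∧ Nonempty (V ≃ₗ[S] BTensor S R C P)

/-- `C`-flat modules: those of the form `C ⊗_R F` with `F` flat. -/
def IsCFlat (V : ModuleCat.{u} S) : Prop :=
  ∃ F : ModuleCat.{u} R, IsFlat F ∧ Nonempty (V ≃ₗ[S] BTensor S R C F)

/-- `C`-weak flat modules: those of the form `C ⊗_R F` with `F` weak flat. -/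
def IsCWeakFlat (V : ModuleCat.{u} S) : Prop :=
  ∃ F : ModuleCat.{u} R, IsWeakFlat F ∧ Nonempty (V ≃ₗ[S] BTensor S R C F)

/-- There is an exact complex `⋯ → V_1 → V_0 → V_{-1} → ⋯` of left `S`-modules, exact also after
applying `Hom_S(C, -)`, with each `V_i` in `𝒳` or in `𝒴`, and with `N ≅ coker (V_1 → V_0)`. -/
def IsCokerOfHomExact {S : Type u} [Ring S] (C : Type u) [AddCommGroup C] [Module S C]
    (𝒳 𝒴 : ModuleCat.{u} S → Prop) (N : ModuleCat.{u} S) : Prop :=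
  ∃ (V : ℤ → ModuleCat.{u} S) (d : ∀ i, V (i + 1) →ₗ[S] V i),
    (∀ i, Function.Exact (d (i + 1)) (d i)) ∧
    (∀ i, Function.Exact (fun f : C →ₗ[S] V (i + 1 + 1) => d (i + 1) ∘ₗ f)
      (fun f : C →ₗ[S] V (i + 1) => d i ∘ₗ f)) ∧
    (∀ i, 𝒳 (V i) ∨ 𝒴 (V i)) ∧
    Nonempty (N ≃ₗ[S] (V 0 ⧸ LinearMap.range (d 0)))

end Bimodule

end Foxby

end

/-! Passing down the list only enlarges the classes (injective ⇒ FP-injective ⇒ weak injective,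
projective ⇒ flat ⇒ weak flat), so the content is (1)⇒(2) and (5)⇒(1).

For (1)⇒(2), let P be a free module covering Hom_S(C,N). Composing with evaluation gives a
surjection C⊗P → N through which every map C → N lifts. On the other side, embed N in an injective
module. The kernel and the cokernel stay in the Bass class, so both steps can be iterated and
spliced (`isCokerOfHomExact_of_steps`).

For (5)⇒(1), the terms of the complex are shown to lie in the Bass class. Resolve C, on one side, by
finitely generated free modules with syzygies L_j. As Ext(C,C) = 0, the duals give exact sequences 0
→ Hom(L_j,C) → C^n → Hom(L_{j+1},C) → 0. They start from Hom(C,C), which is free of rank one by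
homothety, so every Hom(L_j,C) is super finitely presented. Weak injectivity of M can therefore be
tested on these modules: it makes L_j⊗Hom_S(C,M) → Hom_S(Hom(L_j,C),M) bijective, which gives both
the Tor vanishing and the bijectivity of evaluation
(`IsSemidualizing.inBassClass_of_weakInjective`). The mirror argument with Hom(L_j,C)⊗Q →
Hom_S(L_j,C⊗Q) handles weak flat Q (`IsSemidualizing.tensor_weakFlat`).

Finite dimensions follow by induction: the Bass class is closed under cokernels of monomorphisms,
and under kernels of epimorphisms when maps from C lift. For weak injective dimension the lifting
comes from faithfulness (`IsFaithfullySemidualizing.exists_lift`). Finally `inBassClass_of_family`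
treats all cycles of the unbounded complex at once, and N is the quotient of a term by a cycle
module.

Tor is defined by resolving the left module while these arguments resolve C;
`forall_subsingleton_tor_iff` bridges the two. -/

noncomputable section

namespace Foxby

/-! ### Right exactness of the tensor product, and its independence of the left action -/

section TensorExact

section LTensor

set_option linter.unusedSectionVars false

variable {S R X : Type*} [Ring S] [Ring R] [AddCommGroup X] [Module S X] [Module Rᵐᵒᵖ X]
  [SMulCommClass S Rᵐᵒᵖ X]
  {M M' M'' : Type*} [AddCommGroup M] [Module R M] [AddCommGroup M'] [Module R M']
  [AddCommGroup M''] [Module R M'']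

theorem BTensor.tmul_add (x : X) (m m' : M) :
    BTensor.tmul S R x (m + m') = BTensor.tmul S R x m + BTensor.tmul S R x m' :=
  map_add (BTensor.mk (S := S) (R := R) x) m m'

theorem BTensor.tmul_zero (x : X) : BTensor.tmul S R x (0 : M) = 0 :=
  map_zero (BTensor.mk (S := S) (R := R) (M := M) x)

theorem BTensor.add_tmul (x x' : X) (m : M) :
    BTensor.tmul S R (x + x') m = BTensor.tmul S R x m + BTensor.tmul S R x' m := by
  simp [BTensor.tmul, TensorProduct.add_tmul]

theorem BTensor.zero_tmul (m : M) : BTensor.tmul S R (0 : X) m = 0 := by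
  simp [BTensor.tmul]

theorem BTensor.smul_tmul' (s : S) (x : X) (m : M) :
    s • BTensor.tmul S R x m = BTensor.tmul S R (s • x) m := by
  rw [← BTensor.mk_apply, ← BTensor.mk_apply, map_smul, LinearMap.smul_apply]

theorem BTensor.sum_tmul {ι : Type*} (t : Finset ι) (x : ι → X) (m : M) :
    BTensor.tmul S R (∑ i ∈ t, x i) m = ∑ i ∈ t, BTensor.tmul S R (x i) m := by
  simp only [← BTensor.mk_apply, map_sum, LinearMap.sum_apply]

theorem BTensor.tmul_sum {ι : Type*} (t : Finset ι) (x : X) (m : ι → M) :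
    BTensor.tmul S R x (∑ i ∈ t, m i) = ∑ i ∈ t, BTensor.tmul S R x (m i) := by
  simp only [← BTensor.mk_apply, map_sum]

theorem BTensor.induction {p : BTensor S R X M → Prop} (z : BTensor S R X M) (zero : p 0)
    (tmul : ∀ x m, p (BTensor.tmul S R x m)) (add : ∀ a b, p a → p b → p (a + b)) : p z := by
  obtain ⟨t, rfl⟩ := Submodule.mkQ_surjective _ z
  induction t using TensorProduct.induction_on with
  | zero => rw [map_zero]; exact zero
  | tmul x m => exact tmul x m
  | add a b ha hb => rw [map_add]; exact add _ _ ha hb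

theorem BTensor.lTensor_mkQ (g : M →ₗ[R] M') (t : X ⊗[ℤ] M) :
    BTensor.lTensor S X g ((balancedRel S R X M).mkQ t) =
      (balancedRel S R X M').mkQ ((g.restrictScalars ℤ).lTensor X t) := by
  induction t using TensorProduct.induction_on with
  | zero => simp
  | tmul x m => rfl
  | add a b ha hb => rw [map_add, map_add, ha, hb, map_add, map_add]

theorem BTensor.lTensor_comp (g : M →ₗ[R] M') (g' : M' →ₗ[R] M'') (z : BTensor S R X M) :
    BTensor.lTensor S X g' (BTensor.lTensor S X g z) = BTensor.lTensor S X (g' ∘ₗ g) z := by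
  induction z using BTensor.induction with
  | zero => simp
  | tmul x m => rfl
  | add a b ha hb => simp only [map_add, ha, hb]

theorem BTensor.lTensor_id (z : BTensor S R X M) :
    BTensor.lTensor S X (LinearMap.id : M →ₗ[R] M) z = z := by
  induction z using BTensor.induction with
  | zero => simp
  | tmul x m => rfl
  | add a b ha hb => simp only [map_add, ha, hb]

theorem BTensor.lTensor_zero (z : BTensor S R X M) :
    BTensor.lTensor S X (0 : M →ₗ[R] M') z = 0 := by
  induction z using BTensor.induction with
  | zero => simp
  | tmul x m => exact BTensor.tmul_zero x
  | add a b ha hb => simp only [map_add, ha, hb, add_zero]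

/-- Since relations lift along surjections, right exactness over `ℤ` passes to the quotient by the
relations. -/
theorem balancedRel_lift {g : M →ₗ[R] M'} (hg : Function.Surjective g) {t : X ⊗[ℤ] M'}
    (ht : t ∈ balancedRel S R X M') :
    ∃ t' ∈ balancedRel S R X M, (g.restrictScalars ℤ).lTensor X t' = t := by
  have key : balancedRel S R X M' ≤ (balancedRel S R X M).map
      (TensorProduct.AlgebraTensorModule.map (LinearMap.id : X →ₗ[S] X) (g.restrictScalars ℤ)) := by
    refine Submodule.span_le.2 ?_
    rintro _ ⟨x, r, m, rfl⟩
    obtain ⟨m, rfl⟩ := hg m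
    exact ⟨_, Submodule.subset_span ⟨x, r, m, rfl⟩, by simp⟩
  obtain ⟨t', h, h'⟩ := key ht
  refine ⟨t', h, ?_⟩
  rw [← h']
  rfl

theorem BTensor.lTensor_surjective {g : M →ₗ[R] M'} (hg : Function.Surjective g) :
    Function.Surjective (BTensor.lTensor S X g) := by
  intro z
  obtain ⟨t, rfl⟩ := Submodule.mkQ_surjective _ z
  obtain ⟨t, rfl⟩ := LinearMap.lTensor_surjective X (g := g.restrictScalars ℤ) hg t
  exact ⟨_, BTensor.lTensor_mkQ g t⟩

theorem BTensor.lTensor_exact {f : M →ₗ[R] M'} {g : M' →ₗ[R] M''} (h : Function.Exact f g)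
    (hg : Function.Surjective g) :
    Function.Exact (BTensor.lTensor S X f) (BTensor.lTensor S X g) := by
  intro z
  constructor
  · intro hz
    obtain ⟨t, rfl⟩ := Submodule.mkQ_surjective _ z
    rw [BTensor.lTensor_mkQ, Submodule.mkQ_apply, Submodule.Quotient.mk_eq_zero] at hz
    obtain ⟨t', ht', e⟩ := balancedRel_lift hg hz
    have hex : Function.Exact ((f.restrictScalars ℤ).lTensor X) ((g.restrictScalars ℤ).lTensor X) :=
      _root_.lTensor_exact X (fun y => h y) hg
    obtain ⟨w, hw⟩ := (hex (t - t')).1 (by rw [map_sub, e, sub_self])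
    refine ⟨(balancedRel S R X M).mkQ w, ?_⟩
    rw [BTensor.lTensor_mkQ, hw, map_sub, sub_eq_self, Submodule.mkQ_apply,
      Submodule.Quotient.mk_eq_zero]
    exact ht'
  · rintro ⟨w, rfl⟩
    rw [BTensor.lTensor_comp, h.linearMap_comp_eq_zero, BTensor.lTensor_zero]

/-- The tensor product as an abelian group does not depend on the left action. -/
theorem mem_balancedRel_int {t : X ⊗[ℤ] M} (ht : t ∈ balancedRel S R X M) :
    t ∈ balancedRel ℤ R X M := by
  refine Submodule.span_induction (p := fun t _ => t ∈ balancedRel ℤ R X M)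
    (fun t h => Submodule.subset_span h) (Submodule.zero_mem _)
    (fun _ _ _ _ h h' => Submodule.add_mem _ h h') (fun s t _ h => ?_) ht
  refine Submodule.span_induction (p := fun t _ => s • t ∈ balancedRel ℤ R X M) ?_ ?_ ?_ ?_ h
  · rintro _ ⟨x, r, m, rfl⟩
    refine Submodule.subset_span ⟨s • x, r, m, ?_⟩
    rw [smul_sub, TensorProduct.smul_tmul', TensorProduct.smul_tmul', smul_comm]
  · simp
  · intro a b _ _ ha hb
    rw [smul_add]
    exact Submodule.add_mem _ ha hb
  · intro k a _ ha
    rw [smul_comm]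
    exact Submodule.smul_mem _ _ ha

variable (S R X M) in
/-- The canonical map from the tensor product as an abelian group. -/
def BTensor.ofInt : BTensor ℤ R X M →ₗ[ℤ] BTensor S R X M :=
  BTensor.lift
    { toFun := fun x => BTensor.mk x
      map_add' := fun x x' => map_add _ x x'
      map_smul' := fun k x => map_zsmul (BTensor.mk (S := S) (R := R)) k x }
    (fun x r m => BTensor.smul_tmul S R x r m)

@[simp] theorem BTensor.ofInt_tmul (x : X) (m : M) :
    BTensor.ofInt S R X M (BTensor.tmul ℤ R x m) = BTensor.tmul S R x m := rfl

theorem BTensor.ofInt_mkQ (t : X ⊗[ℤ] M) :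
    BTensor.ofInt S R X M ((balancedRel ℤ R X M).mkQ t) = (balancedRel S R X M).mkQ t := by
  induction t using TensorProduct.induction_on with
  | zero => simp
  | tmul x m => rfl
  | add a b ha hb => rw [map_add, map_add, ha, hb, map_add]

theorem BTensor.ofInt_bijective : Function.Bijective (BTensor.ofInt S R X M) := by
  constructor
  · rw [injective_iff_map_eq_zero]
    intro z hz
    obtain ⟨t, rfl⟩ := Submodule.mkQ_surjective _ z
    rw [BTensor.ofInt_mkQ, Submodule.mkQ_apply, Submodule.Quotient.mk_eq_zero] at hz
    rw [Submodule.mkQ_apply, Submodule.Quotient.mk_eq_zero]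
    exact mem_balancedRel_int hz
  · intro z
    obtain ⟨t, rfl⟩ := Submodule.mkQ_surjective _ z
    exact ⟨_, BTensor.ofInt_mkQ t⟩

theorem BTensor.ofInt_lTensor (g : M →ₗ[R] M') (z : BTensor ℤ R X M) :
    BTensor.ofInt S R X M' (BTensor.lTensor ℤ X g z) =
      BTensor.lTensor S X g (BTensor.ofInt S R X M z) := by
  induction z using BTensor.induction with
  | zero => simp
  | tmul x m => rfl
  | add a b ha hb => simp only [map_add, ha, hb]

theorem BTensor.lTensor_injective_iff (g : M →ₗ[R] M') :
    Function.Injective (BTensor.lTensor S X g) ↔ Function.Injective (BTensor.lTensor ℤ X g) := by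
  have e : BTensor.ofInt S R X M' ∘ BTensor.lTensor ℤ X g =
      BTensor.lTensor S X g ∘ BTensor.ofInt S R X M := funext (BTensor.ofInt_lTensor g)
  have h := (BTensor.ofInt_bijective (S := S) (R := R) (X := X) (M := M))
  have h' := (BTensor.ofInt_bijective (S := S) (R := R) (X := X) (M := M'))
  rw [← h'.1.of_comp_iff, e, Function.Injective.of_comp_iff' _ h]

end LTensor

section RTensor

variable {R : Type*} [Ring R] {X Y Z : Type*} [AddCommGroup X] [Module Rᵐᵒᵖ X]
  [AddCommGroup Y] [Module Rᵐᵒᵖ Y] [AddCommGroup Z] [Module Rᵐᵒᵖ Z]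
  {M M' : Type*} [AddCommGroup M] [Module R M] [AddCommGroup M'] [Module R M']

@[simp] theorem BTensor.rTensor_tmul (f : X →ₗ[Rᵐᵒᵖ] Y) (x : X) (m : M) :
    BTensor.rTensor M f (BTensor.tmul ℤ R x m) = BTensor.tmul ℤ R (f x) m := rfl

theorem BTensor.rTensor_mkQ (f : X →ₗ[Rᵐᵒᵖ] Y) (t : X ⊗[ℤ] M) :
    BTensor.rTensor M f ((balancedRel ℤ R X M).mkQ t) =
      (balancedRel ℤ R Y M).mkQ ((f.restrictScalars ℤ).rTensor M t) := by
  induction t using TensorProduct.induction_on with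
  | zero => simp
  | tmul x m => rfl
  | add a b ha hb => rw [map_add, map_add, ha, hb, map_add, map_add]

theorem BTensor.rTensor_comp (f : X →ₗ[Rᵐᵒᵖ] Y) (g : Y →ₗ[Rᵐᵒᵖ] Z) (z : BTensor ℤ R X M) :
    BTensor.rTensor M g (BTensor.rTensor M f z) = BTensor.rTensor M (g ∘ₗ f) z := by
  induction z using BTensor.induction with
  | zero => simp
  | tmul x m => rfl
  | add a b ha hb => simp only [map_add, ha, hb]

theorem BTensor.rTensor_zero (z : BTensor ℤ R X M) :
    BTensor.rTensor M (0 : X →ₗ[Rᵐᵒᵖ] Y) z = 0 := by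
  induction z using BTensor.induction with
  | zero => simp
  | tmul x m => exact BTensor.zero_tmul m
  | add a b ha hb => simp only [map_add, ha, hb, add_zero]

theorem BTensor.rTensor_lTensor (f : X →ₗ[Rᵐᵒᵖ] Y) (g : M →ₗ[R] M') (z : BTensor ℤ R X M) :
    BTensor.rTensor M' f (BTensor.lTensor ℤ X g z) =
      BTensor.lTensor ℤ Y g (BTensor.rTensor M f z) := by
  induction z using BTensor.induction with
  | zero => simp
  | tmul x m => rfl
  | add a b ha hb => simp only [map_add, ha, hb]

theorem balancedRel_lift_right {g : X →ₗ[Rᵐᵒᵖ] Y} (hg : Function.Surjective g) {t : Y ⊗[ℤ] M}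
    (ht : t ∈ balancedRel ℤ R Y M) :
    ∃ t' ∈ balancedRel ℤ R X M, (g.restrictScalars ℤ).rTensor M t' = t := by
  have key : balancedRel ℤ R Y M ≤ (balancedRel ℤ R X M).map
      ((g.restrictScalars ℤ).rTensor M) := by
    refine Submodule.span_le.2 ?_
    rintro _ ⟨x, r, m, rfl⟩
    obtain ⟨x, rfl⟩ := hg x
    exact ⟨_, Submodule.subset_span ⟨x, r, m, rfl⟩, by simp⟩
  exact key ht

theorem BTensor.rTensor_surjective {g : X →ₗ[Rᵐᵒᵖ] Y} (hg : Function.Surjective g) :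
    Function.Surjective (BTensor.rTensor M g) := by
  intro z
  obtain ⟨t, rfl⟩ := Submodule.mkQ_surjective _ z
  obtain ⟨t, rfl⟩ := LinearMap.rTensor_surjective M (g := g.restrictScalars ℤ) hg t
  exact ⟨_, BTensor.rTensor_mkQ g t⟩

theorem BTensor.rTensor_exact {f : X →ₗ[Rᵐᵒᵖ] Y} {g : Y →ₗ[Rᵐᵒᵖ] Z} (h : Function.Exact f g)
    (hg : Function.Surjective g) :
    Function.Exact (BTensor.rTensor M f) (BTensor.rTensor M g) := by
  intro z
  constructor
  · intro hz
    obtain ⟨t, rfl⟩ := Submodule.mkQ_surjective _ z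
    rw [BTensor.rTensor_mkQ, Submodule.mkQ_apply, Submodule.Quotient.mk_eq_zero] at hz
    obtain ⟨t', ht', e⟩ := balancedRel_lift_right hg hz
    have hex : Function.Exact ((f.restrictScalars ℤ).rTensor M) ((g.restrictScalars ℤ).rTensor M) :=
      _root_.rTensor_exact M (fun y => h y) hg
    obtain ⟨w, hw⟩ := (hex (t - t')).1 (by rw [map_sub, e, sub_self])
    refine ⟨(balancedRel ℤ R X M).mkQ w, ?_⟩
    rw [BTensor.rTensor_mkQ, hw, map_sub, sub_eq_self, Submodule.mkQ_apply,
      Submodule.Quotient.mk_eq_zero]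
    exact ht'
  · rintro ⟨w, rfl⟩
    rw [BTensor.rTensor_comp, h.linearMap_comp_eq_zero, BTensor.rTensor_zero]

end RTensor

section Chase

/-- In a commutative diagram `A' → B' → C'`, `A → B → C`, `A'' → B''` with right exact rows and
columns, if `B' → B` and `A'' → B''` are injective then so is `C' → C`. -/
theorem injective_of_three_by_three {A' B' C' A B C A'' B'' : Type*}
    [AddCommGroup A'] [AddCommGroup B'] [AddCommGroup C'] [AddCommGroup A] [AddCommGroup B]
    [AddCommGroup C] [AddCommGroup A''] [AddCommGroup B'']
    {f' : A' →+ B'} {g' : B' →+ C'} {f : A →+ B} {g : B →+ C} {f'' : A'' →+ B''}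
    {a : A' →+ A} {b : B' →+ B} {c : C' →+ C} {p : A →+ A''} {q : B →+ B''}
    (hg' : Function.Surjective g') (hfg' : ∀ x, g' (f' x) = 0) (hfg : Function.Exact f g)
    (hap : Function.Exact a p) (hbq : ∀ x, q (b x) = 0)
    (ab : ∀ x, f (a x) = b (f' x)) (bc : ∀ x, g (b x) = c (g' x)) (pq : ∀ x, f'' (p x) = q (f x))
    (hb : Function.Injective b) (hf'' : Function.Injective f'') : Function.Injective c := by
  rw [injective_iff_map_eq_zero]
  intro x hx
  obtain ⟨y, rfl⟩ := hg' x
  obtain ⟨z, hz⟩ := (hfg (b y)).1 (by rw [bc, hx])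
  have hpz : p z = 0 := hf'' (by rw [pq, hz, hbq, map_zero])
  obtain ⟨w, rfl⟩ := (hap z).1 hpz
  have : f' w = y := hb (by rw [← ab, hz])
  rw [← this, hfg']

end Chase

end TensorExact

/-! ### Super finitely presented modules, treated coinductively -/

section SuperFP

variable {A : Type u} [Ring A]

/-- `M` is the quotient of a finitely generated projective module by a module in `𝒦`. -/
def HasSyzygyIn (𝒦 : ModuleCat.{u} A → Prop) (M : ModuleCat.{u} A) : Prop :=
  ∃ (P : ModuleCat.{u} A) (p : P →ₗ[A] M), Module.Finite A P ∧ Module.Projective A P ∧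
    Function.Surjective p ∧ 𝒦 (ModuleCat.of A (LinearMap.ker p))

theorem HasSyzygyIn.mono {𝒦 ℒ : ModuleCat.{u} A → Prop} (h : ∀ M, 𝒦 M → ℒ M)
    {M : ModuleCat.{u} A} (hM : HasSyzygyIn 𝒦 M) : HasSyzygyIn ℒ M := by
  obtain ⟨P, p, h1, h2, h3, h4⟩ := hM
  exact ⟨P, p, h1, h2, h3, h _ h4⟩

/-- The largest class of modules all of whose members have a syzygy in the class. -/
def SyzygyFP (M : ModuleCat.{u} A) : Prop :=
  ∃ 𝒦 : ModuleCat.{u} A → Prop, 𝒦 M ∧ ∀ K, 𝒦 K → HasSyzygyIn 𝒦 K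

theorem SyzygyFP.hasSyzygyIn {M : ModuleCat.{u} A} (h : SyzygyFP M) :
    HasSyzygyIn SyzygyFP M := by
  obtain ⟨𝒦, hM, h𝒦⟩ := h
  exact (h𝒦 M hM).mono fun K hK => ⟨𝒦, hK, h𝒦⟩

/-- A greatest fixed point: by monotonicity, the modules with a syzygy in the class themselves have
syzygies of the same kind. This allows closure properties to be proved one syzygy at a time, without
building resolutions. -/
theorem SyzygyFP.of_hasSyzygyIn {M : ModuleCat.{u} A} (h : HasSyzygyIn SyzygyFP M) :
    SyzygyFP M :=
  ⟨HasSyzygyIn SyzygyFP, h, fun _ hK => hK.mono fun _ => SyzygyFP.hasSyzygyIn⟩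

theorem SyzygyFP.of_equiv {M N : ModuleCat.{u} A} (h : SyzygyFP M) (e : M ≃ₗ[A] N) :
    SyzygyFP N := by
  obtain ⟨P, p, h1, h2, h3, h4⟩ := h.hasSyzygyIn
  refine .of_hasSyzygyIn ⟨P, e.toLinearMap ∘ₗ p, h1, h2, e.surjective.comp h3, ?_⟩
  rwa [LinearEquiv.ker_comp]

theorem SyzygyFP.of_projective {M : ModuleCat.{u} A} (h : Module.Finite A M)
    (h' : Module.Projective A M) : SyzygyFP M := by
  refine ⟨fun K => Module.Finite A K ∧ Module.Projective A K, ⟨h, h'⟩, fun K hK =>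
    ⟨K, LinearMap.id, hK.1, hK.2, Function.surjective_id, ?_⟩⟩
  rw [LinearMap.ker_id]
  exact ⟨inferInstanceAs (Module.Finite A (⊥ : Submodule A K)),
    inferInstanceAs (Module.Projective A (⊥ : Submodule A K))⟩

/-- Coinduction on the class of all such extensions: by the horseshoe construction, the kernel of P
× P' → N is again an extension of one syzygy by another. -/
theorem SyzygyFP.extension {M N Q : ModuleCat.{u} A} {f : M →ₗ[A] N} {g : N →ₗ[A] Q}
    (hf : Function.Injective f) (hfg : Function.Exact f g) (hg : Function.Surjective g)
    (hM : SyzygyFP M) (hQ : SyzygyFP Q) : SyzygyFP N := by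
  refine ⟨fun N => ∃ (M Q : ModuleCat.{u} A) (f : M →ₗ[A] N) (g : N →ₗ[A] Q),
    Function.Injective f ∧ Function.Exact f g ∧ Function.Surjective g ∧ SyzygyFP M ∧ SyzygyFP Q,
    ⟨M, Q, f, g, hf, hfg, hg, hM, hQ⟩, ?_⟩
  rintro N ⟨M, Q, f, g, hf, hfg, hg, hM, hQ⟩
  obtain ⟨P, p, _, _, hp, hkp⟩ := hM.hasSyzygyIn
  obtain ⟨P', q, _, _, hq, hkq⟩ := hQ.hasSyzygyIn
  obtain ⟨q', hq'⟩ := Module.projective_lifting_property g q hg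
  have hq'x : ∀ x, g (q' x) = q x := fun x => LinearMap.congr_fun hq' x
  let r : (P × P') →ₗ[A] N := (f ∘ₗ p).coprod q'
  have hr : ∀ x y, r (x, y) = f (p x) + q' y := fun x y => by simp [r]
  refine ⟨ModuleCat.of A (P × P'), r, inferInstanceAs (Module.Finite A (P × P')),
    inferInstanceAs (Module.Projective A (P × P')), ?_,
    ModuleCat.of A (LinearMap.ker p), ModuleCat.of A (LinearMap.ker q),
    ((LinearMap.inl A P P').restrict (p := LinearMap.ker p) (q := LinearMap.ker r) ?_),
    ((LinearMap.snd A P P').restrict (p := LinearMap.ker r) (q := LinearMap.ker q) ?_),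
    ?_, ?_, ?_, hkp, hkq⟩
  · intro n
    obtain ⟨y, hy⟩ := hq (g n)
    obtain ⟨m, hm⟩ := (hfg (n - q' y)).1 (by rw [map_sub, hq'x, hy, sub_self])
    obtain ⟨x, rfl⟩ := hp m
    exact ⟨(x, y), by rw [hr, hm, sub_add_cancel]⟩
  · intro x hx
    rw [LinearMap.mem_ker] at hx ⊢
    rw [LinearMap.inl_apply, hr, hx, map_zero, map_zero, add_zero]
  · rintro ⟨x, y⟩ hx
    rw [LinearMap.mem_ker, hr] at hx
    rw [LinearMap.mem_ker, LinearMap.snd_apply, ← hq'x, eq_neg_of_add_eq_zero_right hx, map_neg,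
      hfg.apply_apply_eq_zero, neg_zero]
  · intro x y h
    have := congrArg (fun z => (z.1 : P × P').1) h
    exact Subtype.ext this
  · rintro ⟨⟨x, y⟩, hx⟩
    constructor
    · intro h
      have hy : y = 0 := congrArg Subtype.val h
      subst hy
      rw [LinearMap.mem_ker, hr, map_zero, add_zero] at hx
      exact ⟨⟨x, hf (by rw [hx, map_zero])⟩, rfl⟩
    · rintro ⟨z, hz⟩
      have := congrArg (fun z => (z.1 : P × P').2) hz
      exact Subtype.ext this.symm
  · rintro ⟨y, hy⟩
    obtain ⟨m, hm⟩ := (hfg (q' y)).1 (by rw [hq'x]; exact hy)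
    obtain ⟨x, rfl⟩ := hp m
    exact ⟨⟨(-x, y), by rw [LinearMap.mem_ker, hr, map_neg, map_neg, hm, neg_add_cancel]⟩, rfl⟩

theorem SyzygyFP.ker_comp {M N Q : ModuleCat.{u} A} {f : M →ₗ[A] N} {g : N →ₗ[A] Q}
    (hf : Function.Surjective f) (h : SyzygyFP (ModuleCat.of A (LinearMap.ker f)))
    (h' : SyzygyFP (ModuleCat.of A (LinearMap.ker g))) :
    SyzygyFP (ModuleCat.of A (LinearMap.ker (g ∘ₗ f))) := by
  refine SyzygyFP.extension (f := LinearMap.restrict (p := LinearMap.ker f)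
    (q := LinearMap.ker (g ∘ₗ f)) LinearMap.id ?_)
    (g := f.restrict (p := LinearMap.ker (g ∘ₗ f)) (q := LinearMap.ker g) ?_) ?_ ?_ ?_ h h'
  · intro x hx
    rw [LinearMap.mem_ker] at hx
    rw [LinearMap.mem_ker, LinearMap.id_apply, LinearMap.comp_apply, hx, map_zero]
  · exact fun x hx => hx
  · intro x y hxy
    exact Subtype.ext (congrArg (fun z => (z.1 : M)) hxy)
  · rintro ⟨x, hx⟩
    constructor
    · intro h
      exact ⟨⟨x, congrArg Subtype.val h⟩, rfl⟩
    · rintro ⟨z, hz⟩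
      have : z.1 = x := congrArg Subtype.val hz
      exact Subtype.ext (show f x = 0 by rw [← this]; exact z.2)
  · rintro ⟨y, hy⟩
    obtain ⟨x, rfl⟩ := hf y
    exact ⟨⟨x, hy⟩, rfl⟩

/-- For a cover P → N, the kernel of P → Q is an extension of M ≅ ker g by the syzygy of N. -/
theorem SyzygyFP.quotient {M N Q : ModuleCat.{u} A} {f : M →ₗ[A] N} {g : N →ₗ[A] Q}
    (hf : Function.Injective f) (hfg : Function.Exact f g) (hg : Function.Surjective g)
    (hM : SyzygyFP M) (hN : SyzygyFP N) : SyzygyFP Q := by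
  obtain ⟨P, p, h1, h2, hp, hkp⟩ := hN.hasSyzygyIn
  refine .of_hasSyzygyIn ⟨P, g ∘ₗ p, h1, h2, hg.comp hp, hkp.ker_comp hp ?_⟩
  refine hM.of_equiv ((LinearEquiv.ofInjective f hf).trans (LinearEquiv.ofEq _ _ ?_))
  exact hfg.linearMap_ker_eq.symm

theorem SyzygyFP.exists_free {M : ModuleCat.{u} A} (h : SyzygyFP M) :
    ∃ (n : ℕ) (p : (Fin n → A) →ₗ[A] M), Function.Surjective p ∧
      SyzygyFP (ModuleCat.of A (LinearMap.ker p)) := by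
  obtain ⟨P, p, _, _, hp, hkp⟩ := h.hasSyzygyIn
  obtain ⟨n, s, hs⟩ := Module.Finite.exists_fin' A P
  obtain ⟨t, ht⟩ := Module.projective_lifting_property s LinearMap.id hs
  have htx : ∀ x, s (t x) = x := fun x => LinearMap.congr_fun ht x
  refine ⟨n, p ∘ₗ s, hp.comp hs, SyzygyFP.ker_comp (M := ModuleCat.of A (Fin n → A)) hs ?_ hkp⟩
  -- As P is projective, s splits. This retraction makes ker s a direct summand of a finite free
  -- module.
  let r : (Fin n → A) →ₗ[A] LinearMap.ker s :=
    (LinearMap.id - t ∘ₗ s).codRestrict _ fun x => by simp [htx]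
  have hr : r ∘ₗ (LinearMap.ker s).subtype = LinearMap.id := by
    ext x : 2
    have : s x = 0 := x.2
    simp [r, this]
  exact .of_projective
    (Module.Finite.of_surjective r fun x => ⟨x, LinearMap.congr_fun hr x⟩)
    (Module.Projective.of_split (LinearMap.ker s).subtype r hr)

theorem SyzygyFP.pi {M : Type u} [AddCommGroup M] [Module A M]
    (h : SyzygyFP (ModuleCat.of A M)) (n : ℕ) : SyzygyFP (ModuleCat.of A (Fin n → M)) := by
  induction n with
  | zero =>
    exact .of_projective (inferInstanceAs (Module.Finite A (Fin 0 → M)))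
      (inferInstanceAs (Module.Projective A (Fin 0 → M)))
  | succ n ih =>
    refine SyzygyFP.extension (f := LinearMap.single A (fun _ : Fin (n + 1) => M) 0)
      (g := LinearMap.funLeft A M Fin.succ) ?_ ?_ ?_ h ih
    · intro x y hxy
      simpa using congrFun hxy 0
    · intro v
      constructor
      · intro hv
        refine ⟨v 0, funext fun i => ?_⟩
        induction i using Fin.cases with
        | zero => simp
        | succ i => exact (congrFun hv i).symm
      · rintro ⟨m, rfl⟩
        ext i
        exact Pi.single_eq_of_ne (M := fun _ => M) (Fin.succ_ne_zero i) m
    · exact LinearMap.funLeft_surjective_of_injective _ _ _ (Fin.succ_injective n)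

theorem SyzygyFP.finitePresentation {M : ModuleCat.{u} A} (h : SyzygyFP M) :
    Module.FinitePresentation A M := by
  obtain ⟨n, p, hp, hk⟩ := h.exists_free
  obtain ⟨m, q, hq, -⟩ := hk.exists_free
  exact Module.finitePresentation_of_surjective p hp
    (Module.Finite.iff_fg.1 (Module.Finite.of_surjective q hq))

/-- An exact sequence `0 → L_{j+1} → A^{n_j} → L_j → 0` for each `j`, with `L_0 = M`. -/
structure FreeChain (M : Type u) [AddCommGroup M] [Module A M] where
  /-- The syzygies. -/
  L : ℕ → ModuleCat.{u} A
  /-- The ranks. -/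
  n : ℕ → ℕ
  /-- The inclusions. -/
  ι : ∀ j, L (j + 1) →ₗ[A] (Fin (n j) → A)
  /-- The projections. -/
  π : ∀ j, (Fin (n j) → A) →ₗ[A] L j
  /-- The identification of the zeroth syzygy. -/
  e : L 0 ≃ₗ[A] M
  syzygyFP : ∀ j, SyzygyFP (L j)
  ι_injective : ∀ j, Function.Injective (ι j)
  exact : ∀ j, Function.Exact (ι j) (π j)
  π_surjective : ∀ j, Function.Surjective (π j)

theorem SyzygyFP.nonempty_freeChain {M : Type u} [AddCommGroup M] [Module A M]
    (h : SyzygyFP (ModuleCat.of A M)) : Nonempty (FreeChain (A := A) M) := by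
  choose n p hp hk using fun K : {K : ModuleCat.{u} A // SyzygyFP K} => K.2.exists_free
  let Z : ℕ → {K : ModuleCat.{u} A // SyzygyFP K} := fun j =>
    Nat.rec ⟨ModuleCat.of A M, h⟩ (fun _ K => ⟨ModuleCat.of A (LinearMap.ker (p K)), hk K⟩) j
  exact ⟨{
    L := fun j => (Z j).1
    n := fun j => n (Z j)
    ι := fun j => (LinearMap.ker (p (Z j))).subtype
    π := fun j => p (Z j)
    e := LinearEquiv.refl A M
    syzygyFP := fun j => (Z j).2
    ι_injective := fun j => Subtype.val_injective
    exact := fun j => LinearMap.exact_subtype_ker_map (p (Z j))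
    π_surjective := fun j => hp (Z j) }⟩

theorem projective_of_resolution {M : ModuleCat.{u} A} (P : ProjectiveResolution M) (i : ℕ) :
    Module.Projective A (P.complex.X i) :=
  (IsProjective.iff_projective (R := A) _).2 (P.projective i)

theorem function_exact_of_exact {X Y Z : ModuleCat.{u} A} {f : X ⟶ Y} {g : Y ⟶ Z} {w : f ≫ g = 0}
    (h : (ShortComplex.mk f g w).Exact) : Function.Exact f.hom g.hom :=
  (ShortComplex.ShortExact.moduleCat_exact_iff_function_exact _).1 h

/-- The class of modules with an elementwise exact resolution by finitely generated projectives is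
closed under syzygies: drop the last term of the resolution. -/
theorem IsSuperFP.syzygyFP {M : ModuleCat.{u} A} (h : IsSuperFP M) : SyzygyFP M := by
  obtain ⟨P, hP⟩ := h
  refine ⟨fun K => ∃ (Q : ℕ → ModuleCat.{u} A) (d : ∀ i, Q (i + 1) →ₗ[A] Q i) (ε : Q 0 →ₗ[A] K),
    (∀ i, Module.Finite A (Q i) ∧ Module.Projective A (Q i)) ∧
    (∀ i, Function.Exact (d (i + 1)) (d i)) ∧ Function.Exact (d 0) ε ∧ Function.Surjective ε,
    ⟨P.complex.X, fun i => (P.complex.d (i + 1) i).hom, (P.π.f 0).hom,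
      fun i => ⟨hP i, projective_of_resolution P i⟩,
      fun i => function_exact_of_exact (P.exact_succ i), function_exact_of_exact P.exact₀,
      (ModuleCat.epi_iff_surjective _).1 inferInstance⟩, ?_⟩
  rintro K ⟨Q, d, ε, hQ, hd, hε, hε'⟩
  refine ⟨Q 0, ε, (hQ 0).1, (hQ 0).2, hε', fun i => Q (i + 1), fun i => d (i + 1),
    (d 0).codRestrict (LinearMap.ker ε) (fun x => hε.apply_apply_eq_zero x),
    fun i => hQ (i + 1), fun i => hd (i + 1), ?_, ?_⟩
  · intro x
    rw [← hd 0 x]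
    exact ⟨fun h => congrArg Subtype.val h, fun h => Subtype.ext h⟩
  · rintro ⟨x, hx⟩
    obtain ⟨y, rfl⟩ := (hε x).1 hx
    exact ⟨y, rfl⟩

theorem SyzygyFP.isSuperFP {M : ModuleCat.{u} A} (h : SyzygyFP M) : IsSuperFP M := by
  obtain ⟨F⟩ := h.nonempty_freeChain (M := M)
  let X : ℕ → ModuleCat.{u} A := fun j => ModuleCat.of A (Fin (F.n j) → A)
  let d : ∀ j, X (j + 1) ⟶ X j := fun j => ModuleCat.ofHom (F.ι j ∘ₗ F.π (j + 1))
  have hd : ∀ j, Function.Exact (d (j + 1)).hom (d j).hom := by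
    intro j x
    change F.ι j (F.π (j + 1) x) = 0 ↔ ∃ y, F.ι (j + 1) (F.π (j + 2) y) = x
    rw [map_eq_zero_iff _ (F.ι_injective j), F.exact (j + 1) x]
    constructor
    · rintro ⟨y, rfl⟩
      obtain ⟨z, rfl⟩ := F.π_surjective (j + 2) y
      exact ⟨z, rfl⟩
    · rintro ⟨y, rfl⟩
      exact ⟨_, rfl⟩
  have hdd : ∀ j, d (j + 1) ≫ d j = 0 := fun j => by
    ext1
    exact (hd j).linearMap_comp_eq_zero
  let ε : X 0 ⟶ M := ModuleCat.ofHom (F.e.toLinearMap ∘ₗ F.π 0)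
  have hε : Function.Exact (d 0).hom ε.hom := by
    intro x
    change F.e (F.π 0 x) = 0 ↔ ∃ y, F.ι 0 (F.π 1 y) = x
    rw [map_eq_zero_iff _ F.e.injective, F.exact 0 x]
    constructor
    · rintro ⟨y, rfl⟩
      obtain ⟨z, rfl⟩ := F.π_surjective 1 y
      exact ⟨z, rfl⟩
    · rintro ⟨y, rfl⟩
      exact ⟨_, rfl⟩
  have hε' : Function.Surjective ε.hom := F.e.surjective.comp (F.π_surjective 0)
  let K : ChainComplex (ModuleCat.{u} A) ℕ := ChainComplex.of X d hdd
  have hK : ∀ j, K.d (j + 1) j = d j := fun j => ChainComplex.of_d X d j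
  have hKε : K.d 1 0 ≫ ε = 0 := by
    rw [hK 0]
    ext1
    exact hε.linearMap_comp_eq_zero
  have hKe : (ShortComplex.mk _ _ hKε).Exact := by
    rw [ShortComplex.ShortExact.moduleCat_exact_iff_function_exact]
    change Function.Exact (K.d 1 0).hom ε.hom
    rw [hK 0]
    exact hε
  have hproj : ∀ j, Projective (K.X j) := fun j =>
    (IsProjective.iff_projective (R := A) (Fin (F.n j) → A)).1 inferInstance
  have hfin : ∀ j, Module.Finite A (K.X j) := fun j =>
    inferInstanceAs (Module.Finite A (Fin (F.n j) → A))
  refine ⟨{ complex := K, projective := hproj, π := (ChainComplex.toSingle₀Equiv _ _).symm ⟨ε, hKε⟩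
            quasiIso := ⟨fun j => ?_⟩ }, fun j => hfin j⟩
  cases j with
  | zero =>
    rw [ChainComplex.quasiIsoAt₀_iff, ShortComplex.quasiIso_iff_of_zeros']
    · refine (ShortComplex.exact_and_epi_g_iff_of_iso ?_).2
        ⟨hKe, (ModuleCat.epi_iff_surjective _).2 hε'⟩
      exact ShortComplex.isoMk (Iso.refl _) (Iso.refl _) (Iso.refl _)
        ((Category.id_comp _).trans (Category.comp_id _).symm)
        ((Category.id_comp _).trans (Category.comp_id _).symm)
    all_goals rfl
  | succ j =>
    rw [quasiIsoAt_iff_exactAt']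
    · rw [HomologicalComplex.exactAt_iff' _ (j + 1 + 1) (j + 1) j (by simp) (by simp),
        ShortComplex.ShortExact.moduleCat_exact_iff_function_exact]
      change Function.Exact (K.d (j + 1 + 1) (j + 1)).hom (K.d (j + 1) j).hom
      rw [hK, hK]
      exact hd j
    · exact ChainComplex.exactAt_succ_single_obj _ _

end SuperFP

/-! ### Dimension shifting for Ext, and lifting or extension of maps -/

section ExtVanishing

open Abelian

variable {A : Type u} [Ring A] {M N Q : Type u} [AddCommGroup M] [Module A M] [AddCommGroup N]
  [Module A N] [AddCommGroup Q] [Module A Q]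

/-- The functions `f` and `g` form a short exact sequence. -/
structure IsSES (f : M →ₗ[A] N) (g : N →ₗ[A] Q) : Prop where
  injective : Function.Injective f
  exact : Function.Exact f g
  surjective : Function.Surjective g

theorem IsSES.shortExact {f : M →ₗ[A] N} {g : N →ₗ[A] Q} (h : IsSES f g) :
    (ShortComplex.mk (ModuleCat.ofHom f) (ModuleCat.ofHom g)
      (ModuleCat.hom_ext h.exact.linearMap_comp_eq_zero)).ShortExact where
  exact := (ShortComplex.ShortExact.moduleCat_exact_iff_function_exact _).2 h.exact
  mono_f := (ModuleCat.mono_iff_injective _).2 h.injective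
  epi_g := (ModuleCat.epi_iff_surjective _).2 h.surjective

theorem IsSES.ker {g : N →ₗ[A] Q} (hg : Function.Surjective g) :
    IsSES (LinearMap.ker g).subtype g :=
  ⟨Subtype.val_injective, LinearMap.exact_subtype_ker_map g, hg⟩

theorem extVanish_iff {X Y : ModuleCat.{u} A} {i : ℕ} :
    ExtVanish X Y i ↔ ∀ e : Ext X Y i, e = 0 :=
  ⟨fun h e => h.elim e 0, fun h => ⟨fun a b => (h a).trans (h b).symm⟩⟩

theorem extVanish_of_projective {X Y : ModuleCat.{u} A} (h : Module.Projective A X) {i : ℕ}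
    (hi : 1 ≤ i) : ExtVanish X Y i := by
  have : Projective X := (IsProjective.iff_projective (R := A) X).1 h
  obtain ⟨i, rfl⟩ := Nat.exists_eq_add_of_le' hi
  exact Ext.subsingleton_of_projective X Y i

theorem extVanish_of_injDimLE {X Y : ModuleCat.{u} A} {n : ℕ} (h : InjDimLE n Y) {i : ℕ}
    (hi : n < i) : ExtVanish X Y i := by
  have : HasInjectiveDimensionLT Y (n + 1) := h
  exact HasInjectiveDimensionLT.subsingleton Y (n + 1) i hi X

variable {f : M →ₗ[A] N} {g : N →ₗ[A] Q}

section Covariant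

variable (X : ModuleCat.{u} A)

theorem IsSES.extVanish_left (h : IsSES f g) {i : ℕ} (hQ : ExtVanish X (ModuleCat.of A Q) i)
    (hN : ExtVanish X (ModuleCat.of A N) (i + 1)) : ExtVanish X (ModuleCat.of A M) (i + 1) := by
  rw [extVanish_iff] at *
  intro e
  obtain ⟨x, rfl⟩ := Ext.covariant_sequence_exact₁ X h.shortExact e (hN _) rfl
  rw [hQ x, Ext.zero_comp]

theorem IsSES.extVanish_right (h : IsSES f g) {i : ℕ} (hN : ExtVanish X (ModuleCat.of A N) i)
    (hM : ExtVanish X (ModuleCat.of A M) (i + 1)) : ExtVanish X (ModuleCat.of A Q) i := by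
  rw [extVanish_iff] at *
  intro e
  obtain ⟨x, rfl⟩ := Ext.covariant_sequence_exact₃ X h.shortExact e rfl (hM _)
  rw [hN x, Ext.zero_comp]

theorem IsSES.exists_lift (h : IsSES f g) (hM : ExtVanish X (ModuleCat.of A M) 1)
    (φ : X →ₗ[A] Q) : ∃ ψ : X →ₗ[A] N, g ∘ₗ ψ = φ := by
  rw [extVanish_iff] at hM
  obtain ⟨x, hx⟩ := Ext.covariant_sequence_exact₃ X h.shortExact
    (Ext.mk₀ (ModuleCat.ofHom φ : X ⟶ ModuleCat.of A Q)) (zero_add 1) (hM _)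
  obtain ⟨ψ, rfl⟩ := (Ext.mk₀_bijective _ _).2 x
  rw [Ext.mk₀_comp_mk₀] at hx
  exact ⟨ψ.hom, congrArg ModuleCat.Hom.hom ((Ext.mk₀_bijective _ _).1 hx)⟩

/-- Every class in Ext¹(X, M) is the connecting image of some X → Q, and the connecting map kills
those that lift to N. -/
theorem IsSES.extVanish_one_of_lift (h : IsSES f g) (hN : ExtVanish X (ModuleCat.of A N) 1)
    (H : ∀ φ : X →ₗ[A] Q, ∃ ψ : X →ₗ[A] N, g ∘ₗ ψ = φ) : ExtVanish X (ModuleCat.of A M) 1 := by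
  rw [extVanish_iff] at *
  intro e
  obtain ⟨x, rfl⟩ := Ext.covariant_sequence_exact₁ X h.shortExact e (hN _) (zero_add 1)
  obtain ⟨φ, rfl⟩ := (Ext.mk₀_bijective _ _).2 x
  obtain ⟨ψ, hψ⟩ := H φ.hom
  have : φ = ModuleCat.ofHom ψ ≫ ModuleCat.ofHom g := ModuleCat.hom_ext hψ.symm
  rw [this, ← Ext.mk₀_comp_mk₀, Ext.comp_assoc_of_second_deg_zero]
  exact (congrArg (fun z => Ext.comp _ z _) h.shortExact.comp_extClass).trans
    (Ext.comp_zero _ _ _ _ _)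

end Covariant

section Contravariant

variable (Y : ModuleCat.{u} A)

theorem IsSES.extVanish_quotient (h : IsSES f g) {i : ℕ} (hM : ExtVanish (ModuleCat.of A M) Y i)
    (hN : ExtVanish (ModuleCat.of A N) Y (i + 1)) : ExtVanish (ModuleCat.of A Q) Y (i + 1) := by
  rw [extVanish_iff] at *
  intro e
  obtain ⟨x, rfl⟩ := Ext.contravariant_sequence_exact₃ h.shortExact Y e (hN _) (add_comm 1 i)
  rw [hM x, Ext.comp_zero]

theorem IsSES.extVanish_sub (h : IsSES f g) {i : ℕ} (hN : ExtVanish (ModuleCat.of A N) Y i)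
    (hQ : ExtVanish (ModuleCat.of A Q) Y (i + 1)) : ExtVanish (ModuleCat.of A M) Y i := by
  rw [extVanish_iff] at *
  intro e
  obtain ⟨x, rfl⟩ := Ext.contravariant_sequence_exact₁ h.shortExact Y e (add_comm 1 i) (hQ _)
  rw [hN x, Ext.comp_zero]

theorem IsSES.exists_extend (h : IsSES f g) (hQ : ExtVanish (ModuleCat.of A Q) Y 1)
    (φ : M →ₗ[A] Y) : ∃ ψ : N →ₗ[A] Y, ψ ∘ₗ f = φ := by
  rw [extVanish_iff] at hQ
  obtain ⟨x, hx⟩ := Ext.contravariant_sequence_exact₁ h.shortExact Y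
    (Ext.mk₀ (ModuleCat.ofHom φ : ModuleCat.of A M ⟶ Y)) (add_zero 1) (hQ _)
  obtain ⟨ψ, rfl⟩ := (Ext.mk₀_bijective _ _).2 x
  rw [Ext.mk₀_comp_mk₀] at hx
  exact ⟨ψ.hom, congrArg ModuleCat.Hom.hom ((Ext.mk₀_bijective _ _).1 hx)⟩

theorem IsSES.extVanish_one_of_extend (h : IsSES f g) (hN : ExtVanish (ModuleCat.of A N) Y 1)
    (H : ∀ φ : M →ₗ[A] Y, ∃ ψ : N →ₗ[A] Y, ψ ∘ₗ f = φ) : ExtVanish (ModuleCat.of A Q) Y 1 := by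
  rw [extVanish_iff] at *
  intro e
  obtain ⟨x, rfl⟩ := Ext.contravariant_sequence_exact₃ h.shortExact Y e (hN _) (add_zero 1)
  obtain ⟨φ, rfl⟩ := (Ext.mk₀_bijective _ _).2 x
  obtain ⟨ψ, hψ⟩ := H φ.hom
  have : φ = ModuleCat.ofHom f ≫ ModuleCat.ofHom ψ := ModuleCat.hom_ext hψ.symm
  rw [this, ← Ext.mk₀_comp_mk₀, ← Ext.comp_assoc_of_second_deg_zero]
  exact (congrArg (fun z => Ext.comp z _ _) h.shortExact.extClass_comp).trans
    (Ext.zero_comp _ _ _ _ _)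

end Contravariant

theorem extVanish_of_equiv {X Y X' Y' : ModuleCat.{u} A} (e : X ≃ₗ[A] X') (e' : Y ≃ₗ[A] Y') {i : ℕ}
    (h : ExtVanish X Y i) : ExtVanish X' Y' i := by
  have key : ∀ x : Ext X' Y' i, x = 0 := by
    intro x
    have h1 : (Ext.mk₀ (ModuleCat.ofHom e.toLinearMap : X ⟶ X')).comp
      (x.comp (Ext.mk₀ (ModuleCat.ofHom e'.symm.toLinearMap : Y' ⟶ Y)) (add_zero i))
        (zero_add i) = 0 := extVanish_iff.1 h _
    have h2 : (ModuleCat.ofHom e.symm.toLinearMap : X' ⟶ X) ≫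
        (ModuleCat.ofHom e.toLinearMap : X ⟶ X') = 𝟙 X' := by ext; simp
    have h3 : (ModuleCat.ofHom e'.symm.toLinearMap : Y' ⟶ Y) ≫
        (ModuleCat.ofHom e'.toLinearMap : Y ⟶ Y') = 𝟙 Y' := by ext; simp
    have h4 := congrArg (fun z => (Ext.mk₀ (ModuleCat.ofHom e.symm.toLinearMap : X' ⟶ X)).comp
      (z.comp (Ext.mk₀ (ModuleCat.ofHom e'.toLinearMap : Y ⟶ Y')) (add_zero i)) (zero_add i)) h1
    simpa [Ext.mk₀_comp_mk₀_assoc, h2, h3] using h4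
  exact extVanish_iff.2 key

end ExtVanishing

/-! ### Tensoring with free and projective modules; balancing the two variables -/

section Balance

variable {R : Type u} [Ring R]

section Free

variable {X Y : Type*} [AddCommGroup X] [Module R X] [AddCommGroup Y] [Module R Y] {n : ℕ}

variable (R X n) in
/-- The map `R^n ⊗ X → X^n`. -/
def piTensor : BTensor ℤ R (Fin n → Rᵐᵒᵖ) X →ₗ[ℤ] (Fin n → X) :=
  BTensor.lift
    (AddMonoidHom.toIntLinearMap
      { toFun := fun v => AddMonoidHom.toIntLinearMap
          { toFun := fun x i => (v i).unop • x
            map_zero' := by ext; simp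
            map_add' := fun x y => by ext; simp }
        map_zero' := by ext; simp
        map_add' := fun v w => by ext x i; simp [add_smul] })
    (fun v r x => by
      ext i
      change (MulOpposite.op r • v i).unop • x = (v i).unop • r • x
      rw [smul_eq_mul, MulOpposite.unop_mul, mul_smul]
      rfl)

@[simp] theorem piTensor_tmul (v : Fin n → Rᵐᵒᵖ) (x : X) (i : Fin n) :
    piTensor R X n (BTensor.tmul ℤ R v x) i = (v i).unop • x := rfl

theorem eq_sum_piTensor (z : BTensor ℤ R (Fin n → Rᵐᵒᵖ) X) :
    z = ∑ i, BTensor.tmul ℤ R (Pi.single i 1 : Fin n → Rᵐᵒᵖ) (piTensor R X n z i) := by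
  induction z using BTensor.induction with
  | zero => simp [BTensor.tmul_zero]
  | tmul v x =>
    simp only [piTensor_tmul, ← BTensor.smul_tmul, ← BTensor.sum_tmul, MulOpposite.op_unop]
    congr 1
    ext i
    simp [Finset.sum_apply, Pi.single_apply]
  | add a b ha hb =>
    simp only [map_add, Pi.add_apply, BTensor.tmul_add, Finset.sum_add_distrib]
    rw [← ha, ← hb]

theorem piTensor_injective : Function.Injective (piTensor R X n) := by
  intro a b h
  rw [eq_sum_piTensor a, eq_sum_piTensor b, h]

theorem piTensor_lTensor (g : X →ₗ[R] Y) (z : BTensor ℤ R (Fin n → Rᵐᵒᵖ) X) (i : Fin n) :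
    piTensor R Y n (BTensor.lTensor ℤ _ g z) i = g (piTensor R X n z i) := by
  induction z using BTensor.induction with
  | zero => simp
  | tmul v x => simp
  | add a b ha hb => simp only [map_add, Pi.add_apply, ha, hb]

theorem lTensor_pi_injective {g : X →ₗ[R] Y} (hg : Function.Injective g) :
    Function.Injective (BTensor.lTensor ℤ (Fin n → Rᵐᵒᵖ) g) := by
  intro a b h
  refine piTensor_injective (funext fun i => hg ?_)
  rw [← piTensor_lTensor, ← piTensor_lTensor, h]

end Free

section Projective

variable {X Y : Type*} [AddCommGroup X] [Module Rᵐᵒᵖ X] [AddCommGroup Y] [Module Rᵐᵒᵖ Y]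
  {P : Type*} [AddCommGroup P] [Module R P]

/-- The map `X ⊗ P → X^(P)` given by coordinates on `P`. -/
def coordTensor (X : Type*) [AddCommGroup X] [Module Rᵐᵒᵖ X] (s : P →ₗ[R] (P →₀ R)) :
    BTensor ℤ R X P →ₗ[ℤ] (P →₀ X) :=
  BTensor.lift
    (AddMonoidHom.toIntLinearMap
      { toFun := fun x => AddMonoidHom.toIntLinearMap
          { toFun := fun p => (s p).mapRange (fun r => MulOpposite.op r • x) (by simp)
            map_zero' := by ext; simp
            map_add' := fun p q => by ext; simp [add_smul] }
        map_zero' := by ext; simp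
        map_add' := fun x y => by ext; simp })
    (fun x r p => by
      ext q
      change MulOpposite.op (s p q) • MulOpposite.op r • x = MulOpposite.op (s (r • p) q) • x
      rw [smul_smul, map_smul, Finsupp.smul_apply, smul_eq_mul, MulOpposite.op_mul])

theorem coordTensor_tmul (s : P →ₗ[R] (P →₀ R)) (x : X) (p q : P) :
    coordTensor X s (BTensor.tmul ℤ R x p) q = MulOpposite.op (s p q) • x := rfl

theorem coordTensor_rTensor (s : P →ₗ[R] (P →₀ R)) (f : X →ₗ[Rᵐᵒᵖ] Y) (z : BTensor ℤ R X P) (q : P) :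
    coordTensor Y s (BTensor.rTensor P f z) q = f (coordTensor X s z q) := by
  induction z using BTensor.induction with
  | zero => simp
  | tmul x p => simp [coordTensor_tmul]
  | add a b ha hb => simp only [map_add, Finsupp.add_apply, ha, hb]

/-- Coordinates recover the tensor: p = ∑ s(p)_q q gives x ⊗ p = ∑ x s(p)_q ⊗ q. -/
theorem coordTensor_injective {s : P →ₗ[R] (P →₀ R)}
    (hs : Function.LeftInverse (Finsupp.linearCombination R id) s) :
    Function.Injective (coordTensor X s) := by
  have key : ∀ z : BTensor ℤ R X P,
      (coordTensor X s z).sum (fun q x => BTensor.tmul ℤ R x q) = z := by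
    intro z
    induction z using BTensor.induction with
    | zero => simp
    | tmul x p =>
      conv_rhs => rw [← hs p, Finsupp.linearCombination_apply, Finsupp.sum, BTensor.tmul_sum]
      refine (Finsupp.sum_mapRange_index (hf := by simp) fun q => BTensor.zero_tmul q).trans ?_
      exact Finset.sum_congr rfl fun q _ => BTensor.smul_tmul _ _ _ _ _
    | add a b ha hb =>
      rw [map_add, Finsupp.sum_add_index' (fun q => BTensor.zero_tmul q)
        (fun q x y => BTensor.add_tmul x y q), ha, hb]
  intro a b h
  rw [← key a, ← key b, h]

theorem rTensor_injective_of_projective [Module.Projective R P] {f : X →ₗ[Rᵐᵒᵖ] Y}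
    (hf : Function.Injective f) : Function.Injective (BTensor.rTensor P f) := by
  obtain ⟨s, hs⟩ := (Module.projective_def (R := R) (P := P)).1 inferInstance
  intro a b h
  refine coordTensor_injective hs (Finsupp.ext fun q => hf ?_)
  rw [← coordTensor_rTensor, ← coordTensor_rTensor, h]

end Projective

section SES

variable {L' F L : Type u} [AddCommGroup L'] [Module Rᵐᵒᵖ L'] [AddCommGroup F] [Module Rᵐᵒᵖ F]
  [AddCommGroup L] [Module Rᵐᵒᵖ L] {X' P X : Type u} [AddCommGroup X'] [Module R X']
  [AddCommGroup P] [Module R P] [AddCommGroup X] [Module R X]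
  {ι : L' →ₗ[Rᵐᵒᵖ] F} {π : F →ₗ[Rᵐᵒᵖ] L} {f : X' →ₗ[R] P} {g : P →ₗ[R] X}

/-- Balance of Tor₁(L, X) without derived functors: its vanishing, read on a presentation of X,
transfers to a presentation of L by chasing the 3 × 3 diagram of tensor products. -/
theorem rTensor_injective_of_lTensor_injective (h : IsSES ι π) (h' : IsSES f g)
    (h1 : Function.Injective (BTensor.rTensor P ι))
    (h2 : Function.Injective (BTensor.lTensor ℤ L f)) :
    Function.Injective (BTensor.rTensor X ι) :=
  injective_of_three_by_three (f' := (BTensor.lTensor ℤ L' f).toAddMonoidHom)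
    (g' := (BTensor.lTensor ℤ L' g).toAddMonoidHom) (f := (BTensor.lTensor ℤ F f).toAddMonoidHom)
    (g := (BTensor.lTensor ℤ F g).toAddMonoidHom) (f'' := (BTensor.lTensor ℤ L f).toAddMonoidHom)
    (a := (BTensor.rTensor X' ι).toAddMonoidHom) (b := (BTensor.rTensor P ι).toAddMonoidHom)
    (c := (BTensor.rTensor X ι).toAddMonoidHom) (p := (BTensor.rTensor X' π).toAddMonoidHom)
    (q := (BTensor.rTensor P π).toAddMonoidHom)
    (BTensor.lTensor_surjective h'.surjective)
    (BTensor.lTensor_exact h'.exact h'.surjective).apply_apply_eq_zero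
    (BTensor.lTensor_exact h'.exact h'.surjective) (BTensor.rTensor_exact h.exact h.surjective)
    (BTensor.rTensor_exact h.exact h.surjective).apply_apply_eq_zero
    (fun x => (BTensor.rTensor_lTensor _ _ x).symm) (fun x => (BTensor.rTensor_lTensor _ _ x).symm)
    (fun x => (BTensor.rTensor_lTensor _ _ x).symm) h1 h2

theorem lTensor_injective_of_rTensor_injective (h : IsSES ι π) (h' : IsSES f g)
    (h1 : Function.Injective (BTensor.lTensor ℤ F f))
    (h2 : Function.Injective (BTensor.rTensor X ι)) :
    Function.Injective (BTensor.lTensor ℤ L f) :=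
  injective_of_three_by_three (f' := (BTensor.rTensor X' ι).toAddMonoidHom)
    (g' := (BTensor.rTensor X' π).toAddMonoidHom) (f := (BTensor.rTensor P ι).toAddMonoidHom)
    (g := (BTensor.rTensor P π).toAddMonoidHom) (f'' := (BTensor.rTensor X ι).toAddMonoidHom)
    (a := (BTensor.lTensor ℤ L' f).toAddMonoidHom) (b := (BTensor.lTensor ℤ F f).toAddMonoidHom)
    (c := (BTensor.lTensor ℤ L f).toAddMonoidHom) (p := (BTensor.lTensor ℤ L' g).toAddMonoidHom)
    (q := (BTensor.lTensor ℤ F g).toAddMonoidHom)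
    (BTensor.rTensor_surjective h.surjective)
    (BTensor.rTensor_exact h.exact h.surjective).apply_apply_eq_zero
    (BTensor.rTensor_exact h.exact h.surjective) (BTensor.lTensor_exact h'.exact h'.surjective)
    (BTensor.lTensor_exact h'.exact h'.surjective).apply_apply_eq_zero
    (fun x => BTensor.rTensor_lTensor _ _ x) (fun x => BTensor.rTensor_lTensor _ _ x)
    (fun x => BTensor.rTensor_lTensor _ _ x) h1 h2

end SES

end Balance

/-! ### Vanishing of Tor, read on a resolution of either variable -/

section TorVanishing

variable {R : Type u} [Ring R] {S : Type*} [Ring S] {X : Type u} [AddCommGroup X] [Module S X]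
  [Module Rᵐᵒᵖ X] [SMulCommClass S Rᵐᵒᵖ X] {M : ModuleCat.{u} R}

/-- By right exactness the cokernel of X ⊗ d₂ is X ⊗ range d₁, so homology at the middle measures
how far this fails to embed in X ⊗ P₀. -/
theorem exact_lTensor_iff {P₂ P₁ P₀ : Type u} [AddCommGroup P₂] [Module R P₂] [AddCommGroup P₁]
    [Module R P₁] [AddCommGroup P₀] [Module R P₀] {d₂ : P₂ →ₗ[R] P₁} {d₁ : P₁ →ₗ[R] P₀}
    (h : Function.Exact d₂ d₁) :
    Function.Exact (BTensor.lTensor S X d₂) (BTensor.lTensor S X d₁) ↔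
      Function.Injective (BTensor.lTensor S X (LinearMap.range d₁).subtype) := by
  have hr : Function.Exact d₂ d₁.rangeRestrict := fun x => by
    rw [← h x]
    exact ⟨fun h => congrArg Subtype.val h, fun h => Subtype.ext h⟩
  have hs : Function.Surjective d₁.rangeRestrict := d₁.surjective_rangeRestrict
  have he := BTensor.lTensor_exact (S := S) (X := X) hr hs
  have hcomp : ∀ z, BTensor.lTensor S X (LinearMap.range d₁).subtype
      (BTensor.lTensor S X d₁.rangeRestrict z) = BTensor.lTensor S X d₁ z := fun z =>
    BTensor.lTensor_comp _ _ z
  constructor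
  · intro H
    rw [injective_iff_map_eq_zero]
    intro y hy
    obtain ⟨x, rfl⟩ := BTensor.lTensor_surjective (S := S) (X := X) hs y
    rw [hcomp] at hy
    exact (he x).2 ((H x).1 hy)
  · intro H x
    rw [← he x, ← hcomp, map_eq_zero_iff _ H]

theorem subsingleton_tor_succ_iff (P : ProjectiveResolution M) (i : ℕ) :
    Subsingleton (Tor S X (i + 1) M) ↔
      Function.Injective
        (BTensor.lTensor ℤ X (LinearMap.range (P.complex.d (i + 1) i).hom).subtype) := by
  rw [← BTensor.lTensor_injective_iff (S := S),
    ← exact_lTensor_iff (function_exact_of_exact (P.exact_succ i)),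
    ← ModuleCat.isZero_iff_subsingleton]
  refine (P.isoLeftDerivedObj (tensorFunctor S R X) (i + 1)).isZero_iff.trans ?_
  refine (HomologicalComplex.exactAt_iff_isZero_homology _ _).symm.trans ?_
  rw [HomologicalComplex.exactAt_iff' _ (i + 1 + 1) (i + 1) i (by simp) (by simp),
    ShortComplex.ShortExact.moduleCat_exact_iff_function_exact]
  rfl

theorem isSES_range_zero (P : ProjectiveResolution M) :
    IsSES (LinearMap.range (P.complex.d 1 0).hom).subtype (P.π.f 0).hom where
  injective := Subtype.val_injective
  exact := by
    have h : Function.Exact (P.complex.d 1 0).hom (P.π.f 0).hom := function_exact_of_exact P.exact₀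
    rw [LinearMap.exact_iff, h.linearMap_ker_eq, Submodule.range_subtype]
  surjective := (ModuleCat.epi_iff_surjective _).1 inferInstance

theorem isSES_range_succ (P : ProjectiveResolution M) (k : ℕ) :
    IsSES (LinearMap.range (P.complex.d (k + 1 + 1) (k + 1)).hom).subtype
      (P.complex.d (k + 1) k).hom.rangeRestrict where
  injective := Subtype.val_injective
  exact := by
    have h : Function.Exact (P.complex.d (k + 1 + 1) (k + 1)).hom (P.complex.d (k + 1) k).hom :=
      function_exact_of_exact (P.exact_succ k)
    rw [LinearMap.exact_iff, LinearMap.ker_rangeRestrict, h.linearMap_ker_eq,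
      Submodule.range_subtype]
  surjective := LinearMap.surjective_rangeRestrict _

section

variable {L' F L : Type u} [AddCommGroup L'] [Module Rᵐᵒᵖ L'] [AddCommGroup F] [Module Rᵐᵒᵖ F]
  [AddCommGroup L] [Module Rᵐᵒᵖ L]

theorem rTensor_injective_of_tor_one {ι : L' →ₗ[Rᵐᵒᵖ] F} {π : F →ₗ[Rᵐᵒᵖ] L} (h : IsSES ι π)
    (hT : Subsingleton (Tor ℤ L 1 M)) : Function.Injective (BTensor.rTensor M ι) := by
  let P := projectiveResolution M
  have := projective_of_resolution P 0
  exact rTensor_injective_of_lTensor_injective h (isSES_range_zero P)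
    (rTensor_injective_of_projective h.injective) ((subsingleton_tor_succ_iff P 0).1 hT)

theorem subsingleton_tor_one {n : ℕ} {ι : L' →ₗ[Rᵐᵒᵖ] (Fin n → Rᵐᵒᵖ)}
    {π : (Fin n → Rᵐᵒᵖ) →ₗ[Rᵐᵒᵖ] L} (h : IsSES ι π)
    (hι : Function.Injective (BTensor.rTensor M ι)) : Subsingleton (Tor ℤ L 1 M) :=
  (subsingleton_tor_succ_iff (projectiveResolution M) 0).2
    (lTensor_injective_of_rTensor_injective h (isSES_range_zero _)
      (lTensor_pi_injective (Submodule.injective_subtype _)) hι)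

end

theorem FreeChain.isSES {A : Type u} [Ring A] {M : Type u} [AddCommGroup M] [Module A M]
    (F : FreeChain (A := A) M) (j : ℕ) : IsSES (F.ι j) (F.π j) :=
  ⟨F.ι_injective j, F.exact j, F.π_surjective j⟩

theorem lTensor_injective_of_equiv {X Y : Type*} [AddCommGroup X] [Module Rᵐᵒᵖ X] [AddCommGroup Y]
    [Module Rᵐᵒᵖ Y] (e : X ≃ₗ[Rᵐᵒᵖ] Y) {M N : Type*} [AddCommGroup M] [Module R M]
    [AddCommGroup N] [Module R N] {g : M →ₗ[R] N} (h : Function.Injective (BTensor.lTensor ℤ X g)) :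
    Function.Injective (BTensor.lTensor ℤ Y g) := by
  have hinv : ∀ {N : Type _} [AddCommGroup N] [Module R N] (z : BTensor ℤ R Y N),
      BTensor.rTensor N e.toLinearMap (BTensor.rTensor N e.symm.toLinearMap z) = z := by
    intro N _ _ z
    induction z using BTensor.induction with
    | zero => simp
    | tmul x m => simp
    | add a b ha hb => rw [map_add, map_add, ha, hb]
  intro a b hab
  rw [← hinv a, ← hinv b]
  congr 1
  apply h
  rw [← BTensor.rTensor_lTensor, ← BTensor.rTensor_lTensor, hab]

/-- The vanishing of `Tor` in terms of a resolution of the right module. -/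
theorem forall_subsingleton_tor_iff (F : FreeChain (A := Rᵐᵒᵖ) X) :
    (∀ i ≥ 1, Subsingleton (Tor S X i M)) ↔
      ∀ j, Function.Injective (BTensor.rTensor M (F.ι j)) := by
  let P := projectiveResolution M
  -- With Ω_k the k-th syzygy of M (Ω_0 = M), `D j k` expresses Tor₁(L_j, Ω_k) = 0, which depends
  -- only on j + k.
  let D : ℕ → ℕ → Prop := fun j k => Function.Injective
    (BTensor.lTensor ℤ (F.L j) (LinearMap.range (P.complex.d (k + 1) k).hom).subtype)
  have h1 : (∀ i ≥ 1, Subsingleton (Tor S X i M)) ↔ ∀ k, D 0 k := by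
    constructor
    · intro h k
      exact lTensor_injective_of_equiv F.e.symm
        ((subsingleton_tor_succ_iff P k).1 (h (k + 1) (Nat.le_add_left 1 k)))
    · intro h i hi
      obtain ⟨k, rfl⟩ := Nat.exists_eq_add_of_le' hi
      exact (subsingleton_tor_succ_iff P k).2 (lTensor_injective_of_equiv F.e (h k))
  have h2 : ∀ j k, D j (k + 1) ↔ D (j + 1) k := by
    intro j k
    have := projective_of_resolution P k
    have := projective_of_resolution P (k + 1)
    have hc : ∀ z, BTensor.lTensor ℤ (Fin (F.n j) → Rᵐᵒᵖ)
        (LinearMap.range (P.complex.d (k + 1) k).hom).subtype (BTensor.rTensor _ (F.ι j) z) =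
        BTensor.rTensor _ (F.ι j) (BTensor.lTensor ℤ (F.L (j + 1))
          (LinearMap.range (P.complex.d (k + 1) k).hom).subtype z) := fun z =>
      (BTensor.rTensor_lTensor _ _ z).symm
    have hl := lTensor_pi_injective (n := F.n j)
      (Submodule.injective_subtype (LinearMap.range (P.complex.d (k + 1) k).hom))
    have hr := rTensor_injective_of_projective (P := P.complex.X k) (F.ι_injective j)
    -- Both maps out of L_{j+1} ⊗ Ω_{k+1} become the same map into F_j ⊗ P_k after composing with
    -- injections, F_j being free and P_k projective.
    have hmid : D (j + 1) k ↔ Function.Injective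
        (BTensor.rTensor (LinearMap.range (P.complex.d (k + 1) k).hom) (F.ι j)) := by
      constructor
      · intro h a b hab
        apply h
        apply hr
        rw [← hc, ← hc, hab]
      · intro h a b hab
        apply h
        apply hl
        rw [hc, hc, hab]
    rw [hmid]
    constructor
    · exact rTensor_injective_of_lTensor_injective (F.isSES j) (isSES_range_succ P k)
        (rTensor_injective_of_projective (F.ι_injective j))
    · exact lTensor_injective_of_rTensor_injective (F.isSES j) (isSES_range_succ P k)
        (lTensor_pi_injective (Submodule.injective_subtype _))
  have h3 : ∀ j, D j 0 ↔ Function.Injective (BTensor.rTensor M (F.ι j)) := by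
    intro j
    have := projective_of_resolution P 0
    constructor
    · exact rTensor_injective_of_lTensor_injective (F.isSES j) (isSES_range_zero P)
        (rTensor_injective_of_projective (F.ι_injective j))
    · exact lTensor_injective_of_rTensor_injective (F.isSES j) (isSES_range_zero P)
        (lTensor_pi_injective (Submodule.injective_subtype _))
  have h4 : ∀ k j, D j k ↔ D (j + k) 0 := by
    intro k
    induction k with
    | zero => exact fun j => Iff.rfl
    | succ k ih => exact fun j => by rw [h2, ih, Nat.add_right_comm, Nat.add_assoc]
  rw [h1]
  refine forall_congr' fun k => ?_
  rw [h4, Nat.zero_add, h3]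

end TorVanishing

/-! ### Dualizing a free resolution into C -/

section Duality

variable {A B : Type u} [Ring A] [Ring B] {C : Type u} [AddCommGroup C] [Module A C] [Module B C]
  [SMulCommClass A B C]

variable (B C) in
/-- Precomposition `Hom_A(N, C) → Hom_A(M, C)`, as a `B`-linear map. -/
def precomp {M N : Type*} [AddCommGroup M] [Module A M] [AddCommGroup N] [Module A N]
    (f : M →ₗ[A] N) : (N →ₗ[A] C) →ₗ[B] (M →ₗ[A] C) where
  toFun φ := φ ∘ₗ f
  map_add' _ _ := rfl
  map_smul' _ _ := rfl

@[simp] theorem precomp_apply {M N : Type*} [AddCommGroup M] [Module A M] [AddCommGroup N]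
    [Module A N] (f : M →ₗ[A] N) (φ : N →ₗ[A] C) : precomp B C f φ = φ ∘ₗ f := rfl

theorem IsSES.exists_desc {M N Q Y : Type u} [AddCommGroup M] [Module A M] [AddCommGroup N]
    [Module A N] [AddCommGroup Q] [Module A Q] [AddCommGroup Y] [Module A Y] {f : M →ₗ[A] N}
    {g : N →ₗ[A] Q} (h : IsSES f g) {φ : N →ₗ[A] Y} (hφ : ∀ x, φ (f x) = 0) :
    ∃ ψ : Q →ₗ[A] Y, ψ ∘ₗ g = φ := by
  have hk : LinearMap.ker g ≤ LinearMap.ker φ := by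
    rw [h.exact.linearMap_ker_eq]
    rintro _ ⟨x, rfl⟩
    exact hφ x
  refine ⟨(LinearMap.ker g).liftQ φ hk ∘ₗ
    (g.quotKerEquivOfSurjective h.surjective).symm.toLinearMap, ?_⟩
  ext x
  have : (g.quotKerEquivOfSurjective h.surjective).symm (g x) = (LinearMap.ker g).mkQ x := by
    rw [LinearEquiv.symm_apply_eq]
    rfl
  simp [this]

theorem IsSES.dual {M N Q : Type u} [AddCommGroup M] [Module A M] [AddCommGroup N]
    [Module A N] [AddCommGroup Q] [Module A Q] {f : M →ₗ[A] N} {g : N →ₗ[A] Q} (h : IsSES f g)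
    (hQ : ExtVanish (ModuleCat.of A Q) (ModuleCat.of A C) 1) :
    IsSES (precomp B C g) (precomp B C f) where
  injective φ ψ hφψ := by
    ext x
    obtain ⟨y, rfl⟩ := h.surjective x
    exact LinearMap.congr_fun hφψ y
  exact φ := by
    constructor
    · intro hφ
      exact h.exists_desc fun x => LinearMap.congr_fun hφ x
    · rintro ⟨ψ, rfl⟩
      ext x
      simp [h.exact.apply_apply_eq_zero]
  surjective φ := h.exists_extend (ModuleCat.of A C) hQ φ

theorem FreeChain.extVanish {M : Type u} [AddCommGroup M] [Module A M]
    (F : FreeChain (A := A) M) {Y : ModuleCat.{u} A}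
    (h : ∀ i ≥ 1, ExtVanish (ModuleCat.of A M) Y i) (j : ℕ) : ∀ i ≥ 1, ExtVanish (F.L j) Y i := by
  induction j with
  | zero =>
    exact fun i hi => extVanish_of_equiv (X := ModuleCat.of A M) F.e.symm (LinearEquiv.refl A Y)
      (h i hi)
  | succ j ih =>
    exact fun i hi => (F.isSES j).extVanish_sub Y
      (extVanish_of_projective (inferInstanceAs (Module.Projective A (Fin (F.n j) → A))) hi)
      (ih (i + 1) (by omega))

theorem FreeChain.extVanish_of_one {M : Type u} [AddCommGroup M] [Module A M]
    (F : FreeChain (A := A) M) {Y : ModuleCat.{u} A} (h : ∀ j, ExtVanish (F.L j) Y 1) :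
    ∀ i ≥ 1, ExtVanish (ModuleCat.of A M) Y i := by
  have key : ∀ i j, ExtVanish (F.L j) Y (i + 1) := by
    intro i
    induction i with
    | zero => exact h
    | succ i ih =>
      exact fun j => (F.isSES j).extVanish_quotient Y (ih (j + 1))
        (extVanish_of_projective (inferInstanceAs (Module.Projective A (Fin (F.n j) → A)))
          (by omega))
  intro i hi
  obtain ⟨i, rfl⟩ := Nat.exists_eq_add_of_le' hi
  exact extVanish_of_equiv (X' := ModuleCat.of A M) F.e (LinearEquiv.refl A Y) (key i 0)

/-- Ext vanishing makes 0 → Hom(L_j,C) → C^n → Hom(L_{j+1},C) → 0 exact, so each dual is the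
quotient of C^n by the previous one. -/
theorem FreeChain.syzygyFP_dual {M : Type u} [AddCommGroup M] [Module A M]
    (F : FreeChain (A := A) M) (h : ∀ i ≥ 1, ExtVanish (ModuleCat.of A M) (ModuleCat.of A C) i)
    (hC : SyzygyFP (ModuleCat.of B C)) (hM : SyzygyFP (ModuleCat.of B (M →ₗ[A] C))) (j : ℕ) :
    SyzygyFP (ModuleCat.of B (F.L j →ₗ[A] C)) := by
  induction j with
  | zero =>
    refine hM.of_equiv (N := ModuleCat.of B (F.L 0 →ₗ[A] C))
      { precomp B C F.e.toLinearMap with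
        invFun := precomp B C F.e.symm.toLinearMap
        left_inv := fun φ => ?_
        right_inv := fun φ => ?_ }
    · ext x
      simp
    · ext x
      simp
  | succ j ih =>
    have hS := (F.isSES j).dual (B := B) (C := C) (F.extVanish h j 1 le_rfl)
    refine SyzygyFP.quotient (M := ModuleCat.of B (F.L j →ₗ[A] C))
      (N := ModuleCat.of B ((Fin (F.n j) → A) →ₗ[A] C)) hS.injective hS.exact hS.surjective ih ?_
    exact (hC.pi (F.n j)).of_equiv (N := ModuleCat.of B ((Fin (F.n j) → A) →ₗ[A] C))
      (LinearEquiv.piRing A C (Fin (F.n j)) B).symm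

end Duality

/-! ### Functoriality of Hom_S(C, -) and naturality of evaluation -/

section BHomBasic

set_option linter.unusedSectionVars false

variable {R S C N N' N'' : Type u} [Ring R] [Ring S] [AddCommGroup C] [Module S C] [Module Rᵐᵒᵖ C]
  [SMulCommClass S Rᵐᵒᵖ C] [AddCommGroup N] [Module S N] [AddCommGroup N'] [Module S N']
  [AddCommGroup N''] [Module S N'']

variable (R) in
/-- A linear map as an element of `BHom`. -/
def BHom.of (f : C →ₗ[S] N) : BHom R S C N := f

/-- An element of `BHom` as a linear map. -/
def BHom.hom (f : BHom R S C N) : C →ₗ[S] N := f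

@[simp] theorem BHom.hom_of (f : C →ₗ[S] N) : (BHom.of R f).hom = f := rfl

theorem BHom.ext {f g : BHom R S C N} (h : ∀ c, f.hom c = g.hom c) : f = g :=
  LinearMap.ext h

@[simp] theorem BHom.add_hom (f g : BHom R S C N) (c : C) :
    (f + g).hom c = f.hom c + g.hom c := rfl

@[simp] theorem BHom.zero_hom (c : C) : (0 : BHom R S C N).hom c = 0 := rfl

@[simp] theorem BHom.smul_hom (r : R) (f : BHom R S C N) (c : C) :
    (r • f).hom c = f.hom (MulOpposite.op r • c) := rfl

@[simp] theorem evalMap_tmul (c : C) (f : BHom R S C N) :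
    evalMap R S C N (BTensor.tmul S R c f) = f.hom c := rfl

variable (R C) in
/-- Postcomposition with a linear map. -/
def BHom.map (g : N →ₗ[S] N') : BHom R S C N →ₗ[R] BHom R S C N' where
  toFun f := BHom.of R (g ∘ₗ f.hom)
  map_add' _ _ := BHom.ext fun _ => map_add g _ _
  map_smul' _ _ := rfl

@[simp] theorem BHom.map_hom (g : N →ₗ[S] N') (f : BHom R S C N) (c : C) :
    (BHom.map R C g f).hom c = g (f.hom c) := rfl

theorem evalMap_lTensor (g : N →ₗ[S] N') (z : BTensor S R C (BHom R S C N)) :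
    evalMap R S C N' (BTensor.lTensor S C (BHom.map R C g) z) = g (evalMap R S C N z) := by
  induction z using BTensor.induction with
  | zero => simp
  | tmul c f => simp
  | add a b ha hb => simp only [map_add, ha, hb]

theorem BHom.map_isSES {f : N →ₗ[S] N'} {g : N' →ₗ[S] N''} (h : IsSES f g)
    (hl : ∀ φ : C →ₗ[S] N'', ∃ ψ : C →ₗ[S] N', g ∘ₗ ψ = φ) :
    IsSES (BHom.map R C f) (BHom.map R C g) where
  injective φ ψ e := BHom.ext fun c => h.injective congr(($e).hom c)
  exact φ := by
    constructor
    · intro hφ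
      have hφ' : ∀ c, φ.hom c ∈ LinearMap.range f := fun c =>
        (h.exact _).1 congr(($hφ).hom c)
      refine ⟨BHom.of R ((LinearEquiv.ofInjective f h.injective).symm.toLinearMap ∘ₗ
        φ.hom.codRestrict _ hφ'), BHom.ext fun c => ?_⟩
      exact congrArg Subtype.val
        ((LinearEquiv.ofInjective f h.injective).apply_symm_apply ⟨φ.hom c, hφ' c⟩)
    · rintro ⟨ψ, rfl⟩
      exact BHom.ext fun c => h.exact.apply_apply_eq_zero _
  surjective φ := by
    obtain ⟨ψ, hψ⟩ := hl φ.hom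
    exact ⟨BHom.of R ψ, BHom.ext fun c => LinearMap.congr_fun hψ c⟩

end BHomBasic

/-! ### Hom evaluation, for weak injective modules -/

section Theta

variable {R S : Type u} [Ring R] [Ring S] {C : Type u} [AddCommGroup C] [Module S C]
  [Module Rᵐᵒᵖ C] [SMulCommClass S Rᵐᵒᵖ C] [SMulCommClass Rᵐᵒᵖ S C]
  {M : Type u} [AddCommGroup M] [Module S M]

/-- The map `L ⊗_R Hom_S(C, M) → Hom_S(Hom_{Rᵒᵖ}(L, C), M)`, `l ⊗ f ↦ (φ ↦ f (φ l))`. -/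
def homEval (R S C M : Type u) [Ring R] [Ring S] [AddCommGroup C] [Module S C] [Module Rᵐᵒᵖ C]
    [SMulCommClass S Rᵐᵒᵖ C] [SMulCommClass Rᵐᵒᵖ S C] [AddCommGroup M] [Module S M]
    (L : Type u) [AddCommGroup L] [Module Rᵐᵒᵖ L] :
    BTensor ℤ R L (BHom R S C M) →ₗ[ℤ] ((L →ₗ[Rᵐᵒᵖ] C) →ₗ[S] M) :=
  BTensor.lift
    (AddMonoidHom.toIntLinearMap
      { toFun := fun l => AddMonoidHom.toIntLinearMap
          { toFun := fun f =>
              { toFun := fun φ => f.hom (φ l)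
                map_add' := fun φ ψ => by simp
                map_smul' := fun s φ => by simp }
            map_zero' := by ext; simp
            map_add' := fun f g => by ext; simp }
        map_zero' := by ext; simp
        map_add' := fun l l' => by ext; simp })
    (fun l r f => by
      ext φ
      change f.hom (φ (MulOpposite.op r • l)) = f.hom (MulOpposite.op r • φ l)
      rw [map_smul])

@[simp] theorem homEval_tmul {L : Type u} [AddCommGroup L] [Module Rᵐᵒᵖ L] (l : L)
    (f : BHom R S C M) (φ : L →ₗ[Rᵐᵒᵖ] C) :
    homEval R S C M L (BTensor.tmul ℤ R l f) φ = f.hom (φ l) := rfl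

theorem homEval_rTensor {L L' : Type u} [AddCommGroup L] [Module Rᵐᵒᵖ L] [AddCommGroup L']
    [Module Rᵐᵒᵖ L'] (g : L →ₗ[Rᵐᵒᵖ] L') (z : BTensor ℤ R L (BHom R S C M)) (φ : L' →ₗ[Rᵐᵒᵖ] C) :
    homEval R S C M L' (BTensor.rTensor _ g z) φ = homEval R S C M L z (φ ∘ₗ g) := by
  induction z using BTensor.induction with
  | zero => simp
  | tmul l f => simp
  | add a b ha hb => simp only [map_add, LinearMap.add_apply, ha, hb]

/-- The map `v ↦ v_i c`. -/
def coordMap {A C : Type*} [Ring A] [AddCommGroup C] [Module A C] {n : ℕ} (i : Fin n) (c : C) :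
    (Fin n → A) →ₗ[A] C :=
  LinearMap.toSpanSingleton A C c ∘ₗ LinearMap.proj i

@[simp] theorem coordMap_apply {A C : Type*} [Ring A] [AddCommGroup C] [Module A C] {n : ℕ}
    (i : Fin n) (c : C) (v : Fin n → A) : coordMap i c v = v i • c := rfl

theorem sum_coordMap {A C : Type*} [Ring A] [AddCommGroup C] [Module A C] {n : ℕ}
    (φ : (Fin n → A) →ₗ[A] C) : ∑ i, coordMap i (φ (Pi.single i 1)) = φ := by
  ext i
  simp [Pi.single_apply]

theorem homEval_coordMap {n : ℕ} (z : BTensor ℤ R (Fin n → Rᵐᵒᵖ) (BHom R S C M)) (i : Fin n)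
    (c : C) : homEval R S C M _ z (coordMap i c) = (piTensor R (BHom R S C M) n z i).hom c := by
  induction z using BTensor.induction with
  | zero => simp
  | tmul v f => simp
  | add a b ha hb =>
    simp only [map_add, LinearMap.add_apply, ha, hb, Pi.add_apply, BHom.add_hom]

theorem homEval_pi_injective (n : ℕ) : Function.Injective (homEval R S C M (Fin n → Rᵐᵒᵖ)) := by
  intro a b h
  refine piTensor_injective (funext fun i => BHom.ext fun c => ?_)
  rw [← homEval_coordMap, ← homEval_coordMap, h]

theorem homEval_pi_surjective (n : ℕ) : Function.Surjective (homEval R S C M (Fin n → Rᵐᵒᵖ)) := by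
  intro Φ
  let x : Fin n → BHom R S C M := fun i => BHom.of R
    { toFun := fun c => Φ (coordMap i c)
      map_add' := fun c c' => by
        rw [← map_add]
        congr 1
        ext
        simp
      map_smul' := fun s c => by
        rw [RingHom.id_apply, ← map_smul]
        congr 1
        exact LinearMap.ext fun v => smul_comm _ _ _ }
  refine ⟨∑ i, BTensor.tmul ℤ R (Pi.single i 1 : Fin n → Rᵐᵒᵖ) (x i), ?_⟩
  ext φ
  rw [map_sum, LinearMap.sum_apply]
  conv_rhs => rw [← sum_coordMap φ, map_sum]
  rfl

/-- A five-lemma argument against the free case. Vanishing of Ext¹(Hom(L_{j+1},C), M) extends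
functionals from Hom(L_j,C) to the dual of the free module, which gives surjectivity for all j;
surjectivity at j + 1 then gives injectivity at j. -/
theorem FreeChain.homEval_bijective (F : FreeChain (A := Rᵐᵒᵖ) C)
    (hE : ∀ j, ExtVanish (F.L j) (ModuleCat.of Rᵐᵒᵖ C) 1)
    (hM : ∀ j, ExtVanish (ModuleCat.of S (F.L j →ₗ[Rᵐᵒᵖ] C)) (ModuleCat.of S M) 1) (j : ℕ) :
    Function.Bijective (homEval R S C M (F.L j)) := by
  have hd := fun j => (F.isSES j).dual (B := S) (C := C) (hE j)
  have hsurj : ∀ j, Function.Surjective (homEval R S C M (F.L j)) := by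
    intro j Φ
    obtain ⟨Ψ, hΨ⟩ := (hd j).exists_extend (ModuleCat.of S M) (hM (j + 1)) Φ
    obtain ⟨z, rfl⟩ := homEval_pi_surjective _ Ψ
    refine ⟨BTensor.rTensor _ (F.π j) z, ?_⟩
    ext φ
    rw [homEval_rTensor, ← hΨ]
    rfl
  refine ⟨?_, hsurj j⟩
  rw [injective_iff_map_eq_zero]
  intro z hz
  obtain ⟨y, rfl⟩ := BTensor.rTensor_surjective (F.π_surjective j) z
  have hy : ∀ φ : F.L j →ₗ[Rᵐᵒᵖ] C, homEval R S C M _ y (φ ∘ₗ F.π j) = 0 := fun φ => by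
    rw [← homEval_rTensor, hz, LinearMap.zero_apply]
  obtain ⟨Ψ, hΨ⟩ := (hd j).exists_desc (φ := homEval R S C M _ y) hy
  obtain ⟨w, rfl⟩ := hsurj (j + 1) Ψ
  have : BTensor.rTensor _ (F.ι j) w = y := by
    apply homEval_pi_injective
    ext φ
    rw [homEval_rTensor, ← hΨ]
    rfl
  rw [← this, (BTensor.rTensor_exact (F.exact j) (F.π_surjective j)).apply_apply_eq_zero]

/-- Elements of L_{j+1} ⊗ Hom_S(C,M) are detected by maps L_{j+1} → C, and all of these extend to
the free module. -/
theorem FreeChain.rTensor_injective_of_homEval (F : FreeChain (A := Rᵐᵒᵖ) C)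
    (hE : ∀ j, ExtVanish (F.L j) (ModuleCat.of Rᵐᵒᵖ C) 1)
    (hM : ∀ j, ExtVanish (ModuleCat.of S (F.L j →ₗ[Rᵐᵒᵖ] C)) (ModuleCat.of S M) 1) (j : ℕ) :
    Function.Injective (BTensor.rTensor (BHom R S C M) (F.ι j)) := by
  intro a b hab
  apply (F.homEval_bijective hE hM (j + 1)).1
  ext φ
  obtain ⟨ψ, rfl⟩ := ((F.isSES j).dual (B := S) (C := C) (hE j)).surjective φ
  rw [precomp_apply, ← homEval_rTensor, ← homEval_rTensor, hab]

end Theta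

/-! ### Tensor evaluation, for weak flat modules -/

section Kappa

variable {R S : Type u} [Ring R] [Ring S] {C : Type u} [AddCommGroup C] [Module S C]
  [Module Rᵐᵒᵖ C] [SMulCommClass S Rᵐᵒᵖ C] {Q : Type u} [AddCommGroup Q] [Module R Q]

variable (R S C) in
/-- The map `c ↦ c ⊗ q`. -/
def tmulRight (q : Q) : C →ₗ[S] BTensor S R C Q where
  toFun c := BTensor.tmul S R c q
  map_add' c c' := BTensor.add_tmul c c' q
  map_smul' s c := (BTensor.smul_tmul' s c q).symm

@[simp] theorem tmulRight_apply (q : Q) (c : C) :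
    tmulRight R S C q c = BTensor.tmul S R c q := rfl

/-- The map `Hom_S(L, C) ⊗_R Q → Hom_S(L, C ⊗_R Q)`, `φ ⊗ q ↦ (l ↦ φ l ⊗ q)`. -/
def tensorEval (R S C Q : Type u) [Ring R] [Ring S] [AddCommGroup C] [Module S C]
    [Module Rᵐᵒᵖ C] [SMulCommClass S Rᵐᵒᵖ C] [AddCommGroup Q] [Module R Q]
    (L : Type u) [AddCommGroup L] [Module S L] :
    BTensor ℤ R (L →ₗ[S] C) Q →ₗ[ℤ] (L →ₗ[S] BTensor S R C Q) :=
  BTensor.lift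
    (AddMonoidHom.toIntLinearMap
      { toFun := fun φ => AddMonoidHom.toIntLinearMap
          { toFun := fun q => tmulRight R S C q ∘ₗ φ
            map_zero' := LinearMap.ext fun _ => BTensor.tmul_zero _
            map_add' := fun q q' => LinearMap.ext fun _ => BTensor.tmul_add _ q q' }
        map_zero' := LinearMap.ext fun q => LinearMap.ext fun _ => BTensor.zero_tmul q
        map_add' := fun _ _ => LinearMap.ext fun q => LinearMap.ext fun _ =>
          BTensor.add_tmul _ _ q })
    (fun φ r q => LinearMap.ext fun l => BTensor.smul_tmul S R (φ l) r q)

@[simp] theorem tensorEval_tmul {L : Type u} [AddCommGroup L] [Module S L] (φ : L →ₗ[S] C)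
    (q : Q) (l : L) :
    tensorEval R S C Q L (BTensor.tmul ℤ R φ q) l = BTensor.tmul S R (φ l) q := rfl

theorem tensorEval_rTensor {L L' : Type u} [AddCommGroup L] [Module S L] [AddCommGroup L']
    [Module S L'] (g : L' →ₗ[S] L) (z : BTensor ℤ R (L →ₗ[S] C) Q) :
    tensorEval R S C Q L' (BTensor.rTensor Q (precomp Rᵐᵒᵖ C g) z) =
      tensorEval R S C Q L z ∘ₗ g := by
  induction z using BTensor.induction with
  | zero => simp
  | tmul φ q => rfl
  | add a b ha hb => simp only [map_add, LinearMap.add_comp, ha, hb]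

variable (R S C) in
/-- The map `C → Hom_S(S^n, C)`, `c ↦ (v ↦ v_i c)`, of right modules. -/
def coordMapHom {n : ℕ} (i : Fin n) : C →ₗ[Rᵐᵒᵖ] ((Fin n → S) →ₗ[S] C) where
  toFun c := coordMap i c
  map_add' c c' := LinearMap.ext fun v => smul_add (v i) c c'
  map_smul' r c := LinearMap.ext fun v => smul_comm (v i) r c

variable (R S C Q) in
/-- The isomorphism of the two tensor products of `C` and `Q`. -/
def BTensor.intEquiv : BTensor ℤ R C Q ≃+ BTensor S R C Q :=
  AddEquiv.ofBijective (BTensor.ofInt S R C Q).toAddMonoidHom BTensor.ofInt_bijective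

@[simp] theorem BTensor.intEquiv_symm_tmul (c : C) (q : Q) :
    (BTensor.intEquiv R S C Q).symm (BTensor.tmul S R c q) = BTensor.tmul ℤ R c q :=
  (BTensor.intEquiv R S C Q).symm_apply_apply (BTensor.tmul ℤ R c q)

theorem eq_sum_tensorEval {n : ℕ} (z : BTensor ℤ R ((Fin n → S) →ₗ[S] C) Q) :
    z = ∑ i, BTensor.rTensor Q (coordMapHom R S C i)
      ((BTensor.intEquiv R S C Q).symm (tensorEval R S C Q _ z (Pi.single i 1))) := by
  induction z using BTensor.induction with
  | zero => simp
  | tmul φ q =>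
    conv_lhs => rw [← sum_coordMap φ, BTensor.sum_tmul]
    simp only [tensorEval_tmul, BTensor.intEquiv_symm_tmul, BTensor.rTensor_tmul]
    rfl
  | add a b ha hb =>
    simp only [map_add, LinearMap.add_apply, Finset.sum_add_distrib]
    rw [← ha, ← hb]

theorem tensorEval_pi_injective (n : ℕ) :
    Function.Injective (tensorEval R S C Q (Fin n → S)) := by
  intro a b h
  rw [eq_sum_tensorEval a, eq_sum_tensorEval b, h]

theorem tensorEval_coordMapHom {n : ℕ} (i : Fin n) (t : BTensor ℤ R C Q) (v : Fin n → S) :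
    tensorEval R S C Q _ (BTensor.rTensor Q (coordMapHom R S C i) t) v =
      v i • BTensor.ofInt S R C Q t := by
  induction t using BTensor.induction with
  | zero => simp
  | tmul c q => exact (BTensor.smul_tmul' (R := R) (v i) c q).symm
  | add a b ha hb => simp only [map_add, LinearMap.add_apply, ha, hb, smul_add]

theorem tensorEval_pi_surjective (n : ℕ) :
    Function.Surjective (tensorEval R S C Q (Fin n → S)) := by
  intro Φ
  refine ⟨∑ i, BTensor.rTensor Q (coordMapHom R S C i)
    ((BTensor.intEquiv R S C Q).symm (Φ (Pi.single i 1))), ?_⟩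
  rw [map_sum]
  refine Eq.trans ?_ (sum_coordMap Φ)
  refine Finset.sum_congr rfl fun i _ => LinearMap.ext fun v => ?_
  rw [tensorEval_coordMapHom]
  exact congrArg (v i • ·) ((BTensor.intEquiv R S C Q).apply_symm_apply _)

section

variable (F : FreeChain (A := S) C)
  (hE : ∀ j, ExtVanish (F.L j) (ModuleCat.of S C) 1)
  (hQ : ∀ j, Subsingleton (Tor ℤ (F.L j →ₗ[S] C) 1 (ModuleCat.of R Q)))

include hE hQ

/-- Dual to the Hom case with the order reversed: vanishing of Tor₁(Hom(L_{j+1},C), Q) gives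
injectivity for all j by comparison with the free module, and injectivity at j + 1 gives
surjectivity at j. -/
theorem FreeChain.tensorEval_bijective (j : ℕ) :
    Function.Bijective (tensorEval R S C Q (F.L j)) := by
  have hd := fun j => (F.isSES j).dual (B := Rᵐᵒᵖ) (C := C) (hE j)
  have hcomp : ∀ j z, tensorEval R S C Q _ (BTensor.rTensor Q (precomp Rᵐᵒᵖ C (F.π j)) z) =
      tensorEval R S C Q _ z ∘ₗ F.π j := fun j z => tensorEval_rTensor (F.π j) z
  have hinj : ∀ j, Function.Injective (tensorEval R S C Q (F.L j)) := by
    intro j a b hab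
    apply rTensor_injective_of_tor_one (hd j) (hQ (j + 1))
    apply tensorEval_pi_injective
    rw [hcomp, hcomp, hab]
  refine ⟨hinj j, fun Φ => ?_⟩
  obtain ⟨w, hw⟩ := tensorEval_pi_surjective (F.n j) (Φ ∘ₗ F.π j)
  have h0 : BTensor.rTensor Q (precomp Rᵐᵒᵖ C (F.ι j)) w = 0 := by
    apply hinj
    rw [tensorEval_rTensor, hw, map_zero, LinearMap.comp_assoc,
      (F.exact j).linearMap_comp_eq_zero, LinearMap.comp_zero]
  obtain ⟨z, rfl⟩ := (BTensor.rTensor_exact (hd j).exact (hd j).surjective w).1 h0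
  refine ⟨z, LinearMap.ext fun l => ?_⟩
  obtain ⟨v, rfl⟩ := F.π_surjective j l
  rw [hcomp] at hw
  exact LinearMap.congr_fun hw v

/-- A map L_{j+1} → C ⊗ Q comes from a tensor in Hom(L_{j+1},C) ⊗ Q, which lifts to the dual of the
free module. So the map extends and Ext¹(L_j, C ⊗ Q) = 0. -/
theorem FreeChain.extVanish_tensor :
    ∀ i ≥ 1, ExtVanish (ModuleCat.of S C) (ModuleCat.of S (BTensor S R C Q)) i := by
  refine F.extVanish_of_one fun j => (F.isSES j).extVanish_one_of_extend _
    (extVanish_of_projective (inferInstanceAs (Module.Projective S (Fin (F.n j) → S))) le_rfl) ?_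
  intro φ
  have hd := (F.isSES j).dual (B := Rᵐᵒᵖ) (C := C) (hE j)
  obtain ⟨z, rfl⟩ := (F.tensorEval_bijective hE hQ (j + 1)).2 φ
  obtain ⟨w, rfl⟩ := BTensor.rTensor_surjective hd.surjective z
  exact ⟨tensorEval R S C Q _ w, (tensorEval_rTensor (F.ι j) w).symm⟩

end

end Kappa

section Transfer

variable {R : Type u} {S : Type*} [Ring R] [Ring S] {C : Type u} [AddCommGroup C] [Module S C]
  [Module Rᵐᵒᵖ C] [SMulCommClass S Rᵐᵒᵖ C]

theorem BTensor.lTensor_equiv_bijective {M M' : Type u} [AddCommGroup M] [Module R M]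
    [AddCommGroup M'] [Module R M'] (e : M ≃ₗ[R] M') :
    Function.Bijective (BTensor.lTensor S C e.toLinearMap) := by
  refine Function.bijective_iff_has_inverse.2 ⟨BTensor.lTensor S C e.symm.toLinearMap, ?_, ?_⟩
  · intro z
    rw [BTensor.lTensor_comp, LinearEquiv.comp_coe, e.self_trans_symm]
    exact BTensor.lTensor_id z
  · intro z
    rw [BTensor.lTensor_comp, LinearEquiv.comp_coe, e.symm_trans_self]
    exact BTensor.lTensor_id z

theorem rTensor_injective_of_equiv {L L' : Type u} [AddCommGroup L] [Module Rᵐᵒᵖ L]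
    [AddCommGroup L'] [Module Rᵐᵒᵖ L'] {M M' : Type u} [AddCommGroup M] [Module R M]
    [AddCommGroup M'] [Module R M'] (e : M ≃ₗ[R] M') {f : L →ₗ[Rᵐᵒᵖ] L'}
    (h : Function.Injective (BTensor.rTensor M f)) :
    Function.Injective (BTensor.rTensor M' f) := by
  intro a b hab
  apply (BTensor.lTensor_equiv_bijective (S := ℤ) (C := L) e.symm).1
  apply h
  rw [BTensor.rTensor_lTensor, BTensor.rTensor_lTensor, hab]

end Transfer

/-! ### Weak injective modules and C-weak flat modules lie in the Bass class -/

section Semidualizing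

variable {R S : Type u} [Ring R] [Ring S] {C : Type u} [AddCommGroup C] [Module S C]
  [Module Rᵐᵒᵖ C] [SMulCommClass S Rᵐᵒᵖ C]

theorem IsSemidualizing.syzygyFP_end_right (hC : IsSemidualizing R S C) :
    SyzygyFP (ModuleCat.of Rᵐᵒᵖ (C →ₗ[S] C)) := by
  refine SyzygyFP.of_equiv (M := ModuleCat.of Rᵐᵒᵖ Rᵐᵒᵖ) (.of_projective
    (inferInstanceAs (Module.Finite Rᵐᵒᵖ Rᵐᵒᵖ)) (inferInstanceAs (Module.Projective Rᵐᵒᵖ Rᵐᵒᵖ)))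
    (LinearEquiv.ofBijective (LinearMap.toSpanSingleton Rᵐᵒᵖ (C →ₗ[S] C) LinearMap.id) ?_)
  exact hC.homothety_right.comp MulOpposite.unop_bijective

theorem IsSemidualizing.syzygyFP_end_left [SMulCommClass Rᵐᵒᵖ S C] (hC : IsSemidualizing R S C) :
    SyzygyFP (ModuleCat.of S (C →ₗ[Rᵐᵒᵖ] C)) := by
  refine SyzygyFP.of_equiv (M := ModuleCat.of S S) (.of_projective
    (inferInstanceAs (Module.Finite S S)) (inferInstanceAs (Module.Projective S S)))
    (LinearEquiv.ofBijective (LinearMap.toSpanSingleton S (C →ₗ[Rᵐᵒᵖ] C) LinearMap.id) ?_)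
  exact hC.homothety_left

theorem extVanish_of_syzygyFP {M : ModuleCat.{u} S}
    (hM : ∀ F : ModuleCat.{u} S, SyzygyFP F → ExtVanish F M 1) (i : ℕ) :
    ∀ F : ModuleCat.{u} S, SyzygyFP F → ExtVanish F M (i + 1) := by
  induction i with
  | zero => exact hM
  | succ i ih =>
    intro F hF
    obtain ⟨n, p, hp, hk⟩ := hF.exists_free
    exact (IsSES.ker hp).extVanish_quotient M (ih _ hk)
      (extVanish_of_projective (inferInstanceAs (Module.Projective S (Fin n → S))) (by omega))

/-- At the zeroth syzygy, Hom evaluation becomes C ⊗ Hom_S(C,M) ≅ Hom_S(Hom(C,C),M) ≅ Hom_S(S,M) =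
M, and the composite is evaluation; the higher syzygies give the vanishing of Tor. -/
theorem IsSemidualizing.inBassClass_of_weakInjective (hC : IsSemidualizing R S C)
    {M : ModuleCat.{u} S} (hM : ∀ F : ModuleCat.{u} S, SyzygyFP F → ExtVanish F M 1) :
    InBassClass R C M := by
  have : SMulCommClass Rᵐᵒᵖ S C := SMulCommClass.symm _ _ _
  obtain ⟨F⟩ := hC.superFP_right.syzygyFP.nonempty_freeChain
  have hE : ∀ j, ExtVanish (F.L j) (ModuleCat.of Rᵐᵒᵖ C) 1 := fun j =>
    F.extVanish hC.ext_right j 1 le_rfl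
  have hF : ∀ j, ExtVanish (ModuleCat.of S (F.L j →ₗ[Rᵐᵒᵖ] C)) (ModuleCat.of S M) 1 := fun j =>
    hM _ (F.syzygyFP_dual hC.ext_right hC.superFP_left.syzygyFP hC.syzygyFP_end_left j)
  have hb := F.homEval_bijective hE hF 0
  have hev : ∀ w : BTensor ℤ R C (BHom R S C M),
      evalMap R S C M (BTensor.ofInt S R C _ w) = homEval R S C M C w LinearMap.id := by
    intro w
    induction w using BTensor.induction with
    | zero => simp
    | tmul c f => rfl
    | add a b ha hb => simp only [map_add, LinearMap.add_apply, ha, hb]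
  have he : ∀ w : BTensor ℤ R (F.L 0) (BHom R S C M), ∀ φ,
      homEval R S C M C (BTensor.rTensor _ F.e.toLinearMap w) φ =
        homEval R S C M _ w (φ ∘ₗ F.e.toLinearMap) := homEval_rTensor _
  let h : S ≃ₗ[S] (C →ₗ[Rᵐᵒᵖ] C) := LinearEquiv.ofBijective
    (LinearMap.toSpanSingleton S (C →ₗ[Rᵐᵒᵖ] C) LinearMap.id) hC.homothety_left
  have hh : ∀ s, h s = s • LinearMap.id := fun s => rfl
  refine ⟨fun i hi => ?_, (forall_subsingleton_tor_iff F).2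
    (F.rTensor_injective_of_homEval hE hF), ?_, ?_⟩
  · obtain ⟨i, rfl⟩ := Nat.exists_eq_add_of_le' hi
    exact extVanish_of_syzygyFP hM i _ hC.superFP_left.syzygyFP
  · rw [injective_iff_map_eq_zero]
    intro z hz
    obtain ⟨w, rfl⟩ := BTensor.ofInt_bijective.2 z
    obtain ⟨w, rfl⟩ := BTensor.rTensor_surjective F.e.surjective w
    rw [hev, he] at hz
    have : w = 0 := by
      apply hb.1
      rw [map_zero]
      ext φ
      -- An endomorphism of the right module C is left multiplication by some s, so vanishing at the
      -- identity, up to the isomorphism `F.e`, forces vanishing at every φ.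
      obtain ⟨s, hs⟩ := h.surjective (φ ∘ₗ F.e.symm.toLinearMap)
      have : φ = s • (LinearMap.id ∘ₗ F.e.toLinearMap) := by
        ext l
        have := LinearMap.congr_fun hs (F.e l)
        simpa [hh] using this.symm
      rw [this, map_smul]
      erw [hz]
      simp
    rw [this, map_zero, map_zero]
  · intro m
    obtain ⟨z, hz⟩ := hb.2 (LinearMap.toSpanSingleton S M m ∘ₗ h.symm.toLinearMap ∘ₗ
      precomp S C F.e.symm.toLinearMap)
    refine ⟨BTensor.ofInt S R C _ (BTensor.rTensor _ F.e.toLinearMap z), ?_⟩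
    rw [hev, he, hz]
    have : (LinearMap.id ∘ₗ F.e.toLinearMap) ∘ₗ F.e.symm.toLinearMap = h 1 := by
      ext c
      simp [hh]
    change h.symm ((LinearMap.id ∘ₗ F.e.toLinearMap) ∘ₗ F.e.symm.toLinearMap) • m = m
    rw [this, h.symm_apply_apply, one_smul]

/-- Homothety identifies Hom_S(C,C) ⊗ Q with Q through q ↦ id ⊗ q, and tensor evaluation then
becomes the unit. -/
theorem IsSemidualizing.unit_bijective (hC : IsSemidualizing R S C) {Q : Type u} [AddCommGroup Q]
    [Module R Q] (hQ : Function.Bijective (tensorEval R S C Q C)) :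
    Function.Bijective (tmulRight R S C : Q → C →ₗ[S] BTensor S R C Q) := by
  let h : Rᵐᵒᵖ ≃ₗ[Rᵐᵒᵖ] (C →ₗ[S] C) := LinearEquiv.ofBijective
    (LinearMap.toSpanSingleton Rᵐᵒᵖ (C →ₗ[S] C) LinearMap.id)
    (hC.homothety_right.comp MulOpposite.unop_bijective)
  have hh : ∀ r, h r = r • LinearMap.id := fun r => rfl
  have hid : ∀ q : Q, tensorEval R S C Q C (BTensor.tmul ℤ R LinearMap.id q) = tmulRight R S C q :=
    fun q => rfl
  have hz : ∀ z : BTensor ℤ R (C →ₗ[S] C) Q, ∃ q, z = BTensor.tmul ℤ R LinearMap.id q := by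
    intro z
    induction z using BTensor.induction with
    | zero => exact ⟨0, (BTensor.tmul_zero _).symm⟩
    | tmul φ q =>
      obtain ⟨r, rfl⟩ := h.surjective φ
      exact ⟨r.unop • q, BTensor.smul_tmul ℤ R (LinearMap.id : C →ₗ[S] C) r.unop q⟩
    | add a b ha hb =>
      obtain ⟨q, rfl⟩ := ha
      obtain ⟨q', rfl⟩ := hb
      exact ⟨q + q', (BTensor.tmul_add _ _ _).symm⟩
  let π : BTensor ℤ R (C →ₗ[S] C) Q →ₗ[ℤ] Q := BTensor.lift
    (AddMonoidHom.toIntLinearMap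
      { toFun := fun φ => AddMonoidHom.toIntLinearMap
          { toFun := fun q => (h.symm φ).unop • q
            map_zero' := smul_zero _
            map_add' := fun q q' => smul_add _ q q' }
        map_zero' := by ext; simp
        map_add' := fun φ ψ => by ext; simp [add_smul] })
    (fun φ r q => by
      change (h.symm (MulOpposite.op r • φ)).unop • q = (h.symm φ).unop • r • q
      rw [map_smul, smul_eq_mul, MulOpposite.unop_mul, mul_smul]
      rfl)
  have hπ : ∀ q, π (BTensor.tmul ℤ R LinearMap.id q) = q := by
    intro q
    change (h.symm LinearMap.id).unop • q = q
    have : h.symm LinearMap.id = 1 := by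
      rw [LinearEquiv.symm_apply_eq, hh, one_smul]
    rw [this, MulOpposite.unop_one, one_smul]
  constructor
  · intro q q' hqq
    rw [← hid, ← hid] at hqq
    rw [← hπ q, ← hπ q', hQ.1 hqq]
  · intro φ
    obtain ⟨z, rfl⟩ := hQ.2 φ
    obtain ⟨q, rfl⟩ := hz z
    exact ⟨q, rfl⟩

variable (R S C) in
/-- The unit of the adjunction between `C ⊗_R -` and `Hom_S(C, -)`. -/
def unitMap (Q : Type u) [AddCommGroup Q] [Module R Q] : Q →ₗ[R] BHom R S C (BTensor S R C Q) where
  toFun q := BHom.of R (tmulRight R S C q)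
  map_add' q q' := BHom.ext fun c => BTensor.tmul_add c q q'
  map_smul' r q := BHom.ext fun c => (BTensor.smul_tmul S R c r q).symm

/-- The unit replaces Hom_S(C, C ⊗ Q) by Q. Then Tor(C, Q) vanishes because the syzygies of the
right module C are super finitely presented, and evaluation is inverse to C ⊗ unit by the triangle
identity. -/
theorem IsSemidualizing.tensor_weakFlat (hC : IsSemidualizing R S C) {Q : ModuleCat.{u} R}
    (hQ : IsWeakFlat Q) : Function.Bijective (unitMap R S C Q) ∧
      InBassClass R C (ModuleCat.of S (BTensor S R C Q)) := by
  obtain ⟨F⟩ := hC.superFP_left.syzygyFP.nonempty_freeChain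
  obtain ⟨G⟩ := hC.superFP_right.syzygyFP.nonempty_freeChain
  have hE : ∀ j, ExtVanish (F.L j) (ModuleCat.of S C) 1 := fun j =>
    F.extVanish hC.ext_left j 1 le_rfl
  have hT : ∀ j, Subsingleton (Tor ℤ (F.L j →ₗ[S] C) 1 (ModuleCat.of R Q)) := fun j =>
    hQ (ModuleCat.of Rᵐᵒᵖ (F.L j →ₗ[S] C)) (F.syzygyFP_dual hC.ext_left
      hC.superFP_right.syzygyFP hC.syzygyFP_end_right j).isSuperFP
  have hk : Function.Bijective (tensorEval R S C Q C) := by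
    have h0 := F.tensorEval_bijective hE hT 0
    constructor
    · intro a b hab
      have := fun z => tensorEval_rTensor (Q := Q) (C := C) (R := R) F.e.toLinearMap z
      have key : ∀ z : BTensor ℤ R (C →ₗ[S] C) Q,
          BTensor.rTensor Q (precomp Rᵐᵒᵖ C F.e.symm.toLinearMap)
            (BTensor.rTensor Q (precomp Rᵐᵒᵖ C F.e.toLinearMap) z) = z := by
        intro z
        induction z using BTensor.induction with
        | zero => simp
        | tmul φ q =>
          rw [BTensor.rTensor_tmul, BTensor.rTensor_tmul]
          congr 1
          ext c
          simp
        | add a b ha hb => rw [map_add, map_add, ha, hb]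
      rw [← key a, ← key b]
      congr 1
      apply h0.1
      rw [this, this, hab]
    · intro φ
      obtain ⟨z, hz⟩ := h0.2 (φ ∘ₗ F.e.toLinearMap)
      refine ⟨BTensor.rTensor Q (precomp Rᵐᵒᵖ C F.e.symm.toLinearMap) z, ?_⟩
      rw [tensorEval_rTensor, hz]
      ext c
      simp
  have hu : Function.Bijective (unitMap R S C Q) := hC.unit_bijective hk
  let e : Q ≃ₗ[R] BHom R S C (BTensor S R C Q) := LinearEquiv.ofBijective _ hu
  refine ⟨hu, F.extVanish_tensor hE hT, (forall_subsingleton_tor_iff G).2 fun j =>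
    rTensor_injective_of_equiv (M := Q) e
      (rTensor_injective_of_tor_one (G.isSES j) (hQ _ (G.syzygyFP j).isSuperFP)), ?_⟩
  have hcomp : ∀ z, evalMap R S C (BTensor S R C Q) (BTensor.lTensor S C e.toLinearMap z) = z := by
    intro z
    induction z using BTensor.induction with
    | zero => simp
    | tmul c q => rfl
    | add a b ha hb => rw [map_add, map_add, ha, hb]
  have hb := BTensor.lTensor_equiv_bijective (S := S) (C := C) e
  refine (Function.Bijective.of_comp_iff _ hb).1 ?_
  have : evalMap R S C (BTensor S R C Q) ∘ BTensor.lTensor S C e.toLinearMap = id := funext hcomp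
  rw [this]
  exact Function.bijective_id

end Semidualizing

/-! ### Closure properties of the Bass class -/

section Closure

variable {R S : Type u} [Ring R] [Ring S] {C : Type u} [AddCommGroup C] [Module S C]
  [Module Rᵐᵒᵖ C] [SMulCommClass S Rᵐᵒᵖ C]

section TorShift

variable (G : FreeChain (A := Rᵐᵒᵖ) C) {X' X X'' : Type u} [AddCommGroup X'] [Module R X']
  [AddCommGroup X] [Module R X] [AddCommGroup X''] [Module R X''] {a : X' →ₗ[R] X}
  {b : X →ₗ[R] X''}

theorem FreeChain.lTensor_injective (h : IsSES a b) {j : ℕ}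
    (h' : Function.Injective (BTensor.rTensor X'' (G.ι j))) :
    Function.Injective (BTensor.lTensor ℤ (G.L j) a) :=
  lTensor_injective_of_rTensor_injective (G.isSES j) h (lTensor_pi_injective h.injective) h'

theorem FreeChain.lTensor_injective_succ (h : IsSES a b) {j : ℕ}
    (h' : Function.Injective (BTensor.rTensor X' (G.ι j))) :
    Function.Injective (BTensor.lTensor ℤ (G.L (j + 1)) a) := by
  intro x y hxy
  apply h'
  apply lTensor_pi_injective h.injective
  rw [← BTensor.rTensor_lTensor, ← BTensor.rTensor_lTensor, hxy]

/-- Dimension shift: Tor_{j+1}(C, X') sits between Tor_{j+2}(C, X'') and Tor_{j+1}(C, X). -/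
theorem FreeChain.rTensor_injective_sub (h : IsSES a b) {j : ℕ}
    (h' : Function.Injective (BTensor.rTensor X'' (G.ι (j + 1))))
    (h'' : Function.Injective (BTensor.rTensor X (G.ι j))) :
    Function.Injective (BTensor.rTensor X' (G.ι j)) := by
  intro x y hxy
  apply G.lTensor_injective h h'
  apply h''
  rw [BTensor.rTensor_lTensor, BTensor.rTensor_lTensor, hxy]

theorem FreeChain.lTensor_injective_zero_iff {a : X' →ₗ[R] X} :
    Function.Injective (BTensor.lTensor ℤ (G.L 0) a) ↔
      Function.Injective (BTensor.lTensor S C a) := by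
  refine Iff.trans ?_ (BTensor.lTensor_injective_iff (S := S) (X := C) a).symm
  exact ⟨lTensor_injective_of_equiv G.e, lTensor_injective_of_equiv G.e.symm⟩

end TorShift

variable {N' N N'' : Type u} [AddCommGroup N'] [Module S N'] [AddCommGroup N] [Module S N]
  [AddCommGroup N''] [Module S N''] {f : N' →ₗ[S] N} {g : N →ₗ[S] N''}

theorem IsSES.lTensor_bHom_injective (h : IsSES f g)
    (h' : Function.Injective (evalMap R S C N')) :
    Function.Injective (BTensor.lTensor S C (BHom.map R C f)) := by
  intro x y hxy
  apply h'
  apply h.injective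
  rw [← evalMap_lTensor, ← evalMap_lTensor, hxy]

theorem IsSES.evalMap_surjective_right (h : IsSES f g)
    (hN : Function.Surjective (evalMap R S C N)) : Function.Surjective (evalMap R S C N'') := by
  intro z
  obtain ⟨x, rfl⟩ := h.surjective z
  obtain ⟨w, rfl⟩ := hN x
  exact ⟨_, evalMap_lTensor g w⟩

theorem IsSES.evalMap_injective_right (h : IsSES f g)
    (hl : ∀ φ : C →ₗ[S] N'', ∃ ψ : C →ₗ[S] N, g ∘ₗ ψ = φ)
    (hN : Function.Injective (evalMap R S C N)) (hN' : Function.Surjective (evalMap R S C N')) :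
    Function.Injective (evalMap R S C N'') := by
  have hH := BHom.map_isSES (R := R) h hl
  rw [injective_iff_map_eq_zero]
  intro y hy
  obtain ⟨w, rfl⟩ := BTensor.lTensor_surjective (S := S) (X := C) hH.surjective y
  rw [evalMap_lTensor] at hy
  obtain ⟨x, hx⟩ := (h.exact _).1 hy
  obtain ⟨t, rfl⟩ := hN' x
  rw [← evalMap_lTensor] at hx
  rw [← hN hx]
  exact (BTensor.lTensor_exact hH.exact hH.surjective).apply_apply_eq_zero t

/-- Ext¹(C, N') = 0 keeps the sequence exact under Hom_S(C, -). For Tor₁ the injectivity of C ⊗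
Hom(C,N') → C ⊗ Hom(C,N) is needed, and it comes from that of N' → N through evaluation. -/
theorem InBassClass.right (h : IsSES f g) (hC : IsSemidualizing R S C)
    (hN' : InBassClass R C (ModuleCat.of S N')) (hN : InBassClass R C (ModuleCat.of S N)) :
    InBassClass R C (ModuleCat.of S N'') := by
  obtain ⟨G⟩ := hC.superFP_right.syzygyFP.nonempty_freeChain
  have hl := h.exists_lift (ModuleCat.of S C) (hN'.ext_vanish 1 le_rfl)
  have hH := BHom.map_isSES (R := R) h hl
  have hT' := (forall_subsingleton_tor_iff G).1 hN'.tor_vanish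
  have hT := (forall_subsingleton_tor_iff G).1 hN.tor_vanish
  refine ⟨fun i hi => h.extVanish_right _ (hN.ext_vanish i hi) (hN'.ext_vanish _ (by omega)),
    (forall_subsingleton_tor_iff G).2 fun j => ?_,
    h.evalMap_injective_right hl hN.eval_bijective.1 hN'.eval_bijective.2,
    h.evalMap_surjective_right hN.eval_bijective.2⟩
  refine rTensor_injective_of_lTensor_injective (G.isSES j) hH (hT j) ?_
  cases j with
  | zero =>
    exact G.lTensor_injective_zero_iff.2 (h.lTensor_bHom_injective hN'.eval_bijective.1)
  | succ j => exact G.lTensor_injective_succ hH (hT' j)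

/-- The lifting hypothesis makes up for Ext¹(C, N') = 0, which the long exact sequence alone does
not give. -/
theorem InBassClass.left (h : IsSES f g) (hC : IsSemidualizing R S C)
    (hN : InBassClass R C (ModuleCat.of S N)) (hN'' : InBassClass R C (ModuleCat.of S N''))
    (hl : ∀ φ : C →ₗ[S] N'', ∃ ψ : C →ₗ[S] N, g ∘ₗ ψ = φ) :
    InBassClass R C (ModuleCat.of S N') := by
  obtain ⟨G⟩ := hC.superFP_right.syzygyFP.nonempty_freeChain
  have hH := BHom.map_isSES (R := R) h hl
  have hT := (forall_subsingleton_tor_iff G).1 hN.tor_vanish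
  have hT'' := (forall_subsingleton_tor_iff G).1 hN''.tor_vanish
  have hinj : Function.Injective (BTensor.lTensor S C (BHom.map R C f)) :=
    G.lTensor_injective_zero_iff.1 (G.lTensor_injective hH (hT'' 0))
  refine ⟨fun i hi => ?_, (forall_subsingleton_tor_iff G).2 fun j =>
    G.rTensor_injective_sub hH (hT'' (j + 1)) (hT j), ?_, ?_⟩
  · obtain ⟨i, rfl⟩ := Nat.exists_eq_add_of_le' hi
    cases i with
    | zero => exact h.extVanish_one_of_lift _ (hN.ext_vanish 1 le_rfl) hl
    | succ i =>
      exact h.extVanish_left _ (hN''.ext_vanish (i + 1) (by omega)) (hN.ext_vanish _ (by omega))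
  · intro x y hxy
    apply hinj
    apply hN.eval_bijective.1
    exact (evalMap_lTensor f x).trans ((congrArg f hxy).trans (evalMap_lTensor f y).symm)
  · intro x
    obtain ⟨w, hw⟩ := hN.eval_bijective.2 (f x)
    have h0 : BTensor.lTensor S C (BHom.map R C g) w = 0 := by
      apply hN''.eval_bijective.1
      refine (evalMap_lTensor g w).trans ?_
      rw [map_zero]
      exact (congrArg g hw).trans (h.exact.apply_apply_eq_zero x)
    obtain ⟨t, rfl⟩ := (BTensor.lTensor_exact hH.exact hH.surjective w).1 h0
    refine ⟨t, h.injective ?_⟩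
    exact (evalMap_lTensor f t).symm.trans hw

/-- The character module of a left module, as a right module. -/
def RightDual (_R E : Type*) [AddCommGroup E] : Type _ := E →+ AddCircle (1 : ℚ)

instance (R E : Type*) [AddCommGroup E] : AddCommGroup (RightDual R E) :=
  inferInstanceAs (AddCommGroup (E →+ AddCircle (1 : ℚ)))

instance (R E : Type*) [Ring R] [AddCommGroup E] [Module R E] : Module Rᵐᵒᵖ (RightDual R E) where
  smul r χ := AddMonoidHom.comp (show E →+ AddCircle (1 : ℚ) from χ)
    (DistribSMul.toAddMonoidHom E r.unop)
  one_smul χ := AddMonoidHom.ext fun e => congrArg (show E →+ _ from χ) (one_smul R e)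
  mul_smul r s χ := AddMonoidHom.ext fun e => congrArg (show E →+ _ from χ) (mul_smul s.unop r.unop e)
  smul_zero _ := rfl
  smul_add _ _ _ := rfl
  add_smul r s χ := AddMonoidHom.ext fun e =>
    (congrArg (show E →+ _ from χ) (add_smul r.unop s.unop e)).trans
      (map_add (show E →+ AddCircle (1 : ℚ) from χ) _ _)
  zero_smul χ := AddMonoidHom.ext fun e =>
    (congrArg (show E →+ _ from χ) (zero_smul R e)).trans
      (map_zero (show E →+ AddCircle (1 : ℚ) from χ))

/-- A map from C to the character module of E is a character of C ⊗ E, hence zero. Faithfulness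
kills the character module, and characters separate points. -/
theorem IsFaithfullySemidualizing.subsingleton_of_tensor (hC : IsFaithfullySemidualizing R S C)
    {E : Type u} [AddCommGroup E] [Module R E] (h : Subsingleton (BTensor S R C E)) :
    Subsingleton E := by
  have h' : Subsingleton (BTensor ℤ R C E) :=
    (BTensor.ofInt_bijective (S := S) (R := R) (X := C) (M := E)).1.subsingleton
  have hD : Subsingleton (RightDual R E) := by
    refine hC.faithful_right (ModuleCat.of Rᵐᵒᵖ (RightDual R E))
      (subsingleton_of_forall_eq 0 fun φ => LinearMap.ext fun c => AddMonoidHom.ext fun e => ?_)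
    let φ' : C → E →+ AddCircle (1 : ℚ) := fun c => φ c
    let ψ : BTensor ℤ R C E →ₗ[ℤ] AddCircle (1 : ℚ) := BTensor.lift
      (AddMonoidHom.toIntLinearMap
        { toFun := fun c => AddMonoidHom.toIntLinearMap (φ' c)
          map_zero' := by
            ext e
            exact congrArg (fun χ : E →+ AddCircle (1 : ℚ) => χ e) (map_zero φ)
          map_add' := fun c c' => by
            ext e
            exact congrArg (fun χ : E →+ AddCircle (1 : ℚ) => χ e) (map_add φ c c') })
      (fun c r e => congrArg (fun χ : E →+ AddCircle (1 : ℚ) => χ e)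
        (map_smul φ (MulOpposite.op r) c))
    have : ψ (BTensor.tmul ℤ R c e) = 0 := by
      rw [Subsingleton.elim (BTensor.tmul ℤ R c e) 0, map_zero]
    exact this
  refine subsingleton_of_forall_eq 0 fun e =>
    CharacterModule.eq_zero_of_character_apply (A := E) fun χ => ?_
  have : (show RightDual R E from χ) = 0 := Subsingleton.elim _ _
  exact congrArg (fun χ : E →+ AddCircle (1 : ℚ) => χ e) this

/-- Let E be the cokernel of Hom(C,N) → Hom(C,N''). Tensored with C, this map becomes the surjection
N → N'', so C ⊗ E = 0 and E = 0. -/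
theorem IsFaithfullySemidualizing.exists_lift (hC : IsFaithfullySemidualizing R S C)
    (h : IsSES f g) (hN : InBassClass R C (ModuleCat.of S N))
    (hN'' : InBassClass R C (ModuleCat.of S N'')) (φ : C →ₗ[S] N'') :
    ∃ ψ : C →ₗ[S] N, g ∘ₗ ψ = φ := by
  let q := (LinearMap.range (BHom.map R C g)).mkQ
  have hE : Subsingleton (BHom R S C N'' ⧸ LinearMap.range (BHom.map R C g)) := by
    refine hC.subsingleton_of_tensor (subsingleton_of_forall_eq 0 fun z => ?_)
    obtain ⟨y, rfl⟩ := BTensor.lTensor_surjective (S := S) (X := C)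
      (Submodule.mkQ_surjective _ : Function.Surjective q) z
    obtain ⟨x, hx⟩ := h.surjective (evalMap R S C N'' y)
    obtain ⟨w, hw⟩ := hN.eval_bijective.2 x
    have : BTensor.lTensor S C (BHom.map R C g) w = y := by
      apply hN''.eval_bijective.1
      exact (evalMap_lTensor g w).trans ((congrArg g hw).trans hx)
    rw [← this, BTensor.lTensor_comp, LinearMap.range_mkQ_comp, BTensor.lTensor_zero]
  have hφ : q (BHom.of R φ) = 0 := Subsingleton.elim _ _
  rw [Submodule.mkQ_apply, Submodule.Quotient.mk_eq_zero] at hφ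
  obtain ⟨ψ, hψ⟩ := hφ
  exact ⟨ψ.hom, LinearMap.ext fun c => congr(($hψ).hom c)⟩

theorem IsSemidualizing.inBassClass_punit (hC : IsSemidualizing R S C) :
    InBassClass R C (ModuleCat.of S PUnit.{u + 1}) := by
  refine hC.inBassClass_of_weakInjective fun F _ => ?_
  have hz : Limits.IsZero (ModuleCat.of S PUnit.{u + 1}) := ModuleCat.isZero_of_subsingleton _
  have := hz.hasInjectiveDimensionLT_zero
  exact HasInjectiveDimensionLT.subsingleton _ 0 1 (Nat.zero_le _) F

theorem InBassClass.of_equiv (hC : IsSemidualizing R S C) {M M' : ModuleCat.{u} S}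
    (h : InBassClass R C M) (e : M ≃ₗ[S] M') : InBassClass R C M' := by
  refine InBassClass.right (N' := PUnit.{u + 1}) (N := M) (f := 0) (g := e.toLinearMap)
    ⟨Function.injective_of_subsingleton _, fun x => ?_, e.surjective⟩ hC hC.inBassClass_punit h
  constructor
  · intro hx
    exact ⟨0, (e.map_eq_zero_iff.1 hx).symm⟩
  · rintro ⟨y, rfl⟩
    simp

theorem IsCWeakFlat.inBassClass (hC : IsSemidualizing R S C) {V : ModuleCat.{u} S}
    (h : IsCWeakFlat R C V) : InBassClass R C V := by
  obtain ⟨Q, hQ, ⟨e⟩⟩ := h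
  exact (hC.tensor_weakFlat hQ).2.of_equiv hC e.symm

theorem inBassClass_of_resDimLE (hC : IsSemidualizing R S C) {𝒳 : ModuleCat.{u} S → Prop}
    (h𝒳 : ∀ V, 𝒳 V → InBassClass R C V) (n : ℕ) :
    ∀ M : ModuleCat.{u} S, ResDimLE 𝒳 n M → InBassClass R C M := by
  induction n with
  | zero =>
    rintro M ⟨X, d, ε, hX, h0, hd, hε, hε'⟩
    have := h0 1 one_pos
    have hinj : Function.Injective ε := by
      rw [injective_iff_map_eq_zero]
      intro x hx
      obtain ⟨y, rfl⟩ := (hε x).1 hx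
      rw [Subsingleton.elim y 0, map_zero]
    exact (h𝒳 _ (hX 0 le_rfl)).of_equiv hC (LinearEquiv.ofBijective ε ⟨hinj, hε'⟩)
  | succ n ih =>
    rintro M ⟨X, d, ε, hX, h0, hd, hε, hε'⟩
    refine InBassClass.right (IsSES.ker hε') hC (ih (ModuleCat.of S (LinearMap.ker ε)) ?_)
      (h𝒳 _ (hX 0 (Nat.zero_le _)))
    refine ⟨fun i => X (i + 1), fun i => d (i + 1), (d 0).codRestrict (LinearMap.ker ε)
      (fun x => hε.apply_apply_eq_zero x), fun i hi => hX (i + 1) (by omega),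
      fun i hi => h0 (i + 1) (by omega), fun i => hd (i + 1), fun x => ?_, ?_⟩
    · rw [← hd 0 x]
      exact ⟨fun h => congrArg Subtype.val h, fun h => Subtype.ext h⟩
    · rintro ⟨x, hx⟩
      obtain ⟨y, rfl⟩ := (hε x).1 hx
      exact ⟨y, rfl⟩

/-- Every module embeds in an injective module. -/
theorem exists_injective_embedding (M : ModuleCat.{u} S) :
    ∃ (I : ModuleCat.{u} S) (i : M →ₗ[S] I), InjDimLE 0 I ∧
      IsSES i (LinearMap.range i).mkQ := by
  refine ⟨Injective.under M, (Injective.ι M).hom,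
    injective_iff_hasInjectiveDimensionLT_one.1 inferInstance,
    (ModuleCat.mono_iff_injective _).1 inferInstance, LinearMap.exact_map_mkQ_range _,
    Submodule.mkQ_surjective _⟩

/-- The cokernel of an injective embedding has dimension one less. Returning to M as a kernel
requires lifting maps from C, and this is where faithfulness enters. -/
theorem IsFaithfullySemidualizing.inBassClass_of_weakInjDim (hC : IsFaithfullySemidualizing R S C)
    (m : ℕ) : ∀ M : ModuleCat.{u} S,
      (∀ F : ModuleCat.{u} S, SyzygyFP F → ExtVanish F M (m + 1)) → InBassClass R C M := by
  have hC' := hC.toIsSemidualizing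
  induction m with
  | zero => exact fun M hM => hC'.inBassClass_of_weakInjective hM
  | succ m ih =>
    intro M hM
    obtain ⟨I, i, hI, hi⟩ := exists_injective_embedding M
    have hIB : InBassClass R C I := hC'.inBassClass_of_weakInjective fun F _ =>
      extVanish_of_injDimLE hI one_pos
    have hQ : InBassClass R C (ModuleCat.of S (I ⧸ LinearMap.range i)) :=
      ih _ fun F hF => hi.extVanish_right F (extVanish_of_injDimLE hI (Nat.succ_pos m)) (hM F hF)
    exact InBassClass.left hi hC' hIB hQ (hC.exists_lift hi hIB hQ)

/-- The complex is unbounded, so no induction along it can start. Instead each property is proved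
for all cycles simultaneously, by induction on the Ext or Tor degree, passing between neighbouring
cycles. -/
theorem inBassClass_of_family (hC : IsSemidualizing R S C) {V Z : ℤ → ModuleCat.{u} S}
    {f : ∀ i, Z (i + 1) →ₗ[S] V i} {g : ∀ i, V i →ₗ[S] Z i} (h : ∀ i, IsSES (f i) (g i))
    (hl : ∀ i (φ : C →ₗ[S] Z i), ∃ ψ : C →ₗ[S] V i, g i ∘ₗ ψ = φ)
    (hV : ∀ i, InBassClass R C (V i)) (i : ℤ) : InBassClass R C (Z i) := by
  obtain ⟨G⟩ := hC.superFP_right.syzygyFP.nonempty_freeChain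
  have hH := fun i => BHom.map_isSES (R := R) (h i) (hl i)
  have hE : ∀ k i, ExtVanish (ModuleCat.of S C) (Z i) (k + 1) := by
    intro k
    induction k with
    | zero =>
      have h1 : ∀ i, ExtVanish (ModuleCat.of S C) (Z (i + 1)) 1 := fun i =>
        (h i).extVanish_one_of_lift _ ((hV i).ext_vanish 1 le_rfl) (hl i)
      intro i
      have := h1 (i - 1)
      rwa [sub_add_cancel] at this
    | succ k ih =>
      have h1 : ∀ i, ExtVanish (ModuleCat.of S C) (Z (i + 1)) (k + 1 + 1) := fun i =>
        (h i).extVanish_left _ (ih i) ((hV i).ext_vanish _ (by omega))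
      intro i
      have := h1 (i - 1)
      rwa [sub_add_cancel] at this
  have hsurj : ∀ i, Function.Surjective (evalMap R S C (Z i)) := fun i =>
    (h i).evalMap_surjective_right (hV i).eval_bijective.2
  -- Surjectivity used only the terms V_i; injectivity at i uses surjectivity at the next cycle i +
  -- 1.
  have hinj : ∀ i, Function.Injective (evalMap R S C (Z i)) := fun i =>
    (h i).evalMap_injective_right (hl i) (hV i).eval_bijective.1 (hsurj (i + 1))
  have hT : ∀ j i, Function.Injective (BTensor.rTensor (BHom R S C (Z i)) (G.ι j)) := by
    intro j
    induction j with
    | zero =>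
      exact fun i => rTensor_injective_of_lTensor_injective (G.isSES 0) (hH i)
        ((forall_subsingleton_tor_iff G).1 (hV i).tor_vanish 0)
        (G.lTensor_injective_zero_iff.2 ((h i).lTensor_bHom_injective (hinj (i + 1))))
    | succ j ih =>
      exact fun i => rTensor_injective_of_lTensor_injective (G.isSES (j + 1)) (hH i)
        ((forall_subsingleton_tor_iff G).1 (hV i).tor_vanish (j + 1))
        (G.lTensor_injective_succ (hH i) (ih (i + 1)))
  refine ⟨fun k hk => ?_, (forall_subsingleton_tor_iff G).2 fun j => hT j i, hinj i, hsurj i⟩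
  obtain ⟨k, rfl⟩ := Nat.exists_eq_add_of_le' hk
  exact hE k i

end Closure

/-! ### Splicing short exact sequences into a two-sided complex -/

section Splicing

variable {S : Type u} [Ring S] {C : Type u} [AddCommGroup C] [Module S C]
  {𝒳 𝒴 𝒳' 𝒴' : ModuleCat.{u} S → Prop}

theorem IsCokerOfHomExact.mono {N : ModuleCat.{u} S} (h : IsCokerOfHomExact C 𝒳 𝒴 N)
    (hX : ∀ V, 𝒳 V → 𝒳' V) (hY : ∀ V, 𝒴 V → 𝒴' V) : IsCokerOfHomExact C 𝒳' 𝒴' N := by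
  obtain ⟨V, d, h1, h2, h3, h4⟩ := h
  exact ⟨V, d, h1, h2, fun i => (h3 i).imp (hX _) (hY _), h4⟩

theorem ResDimLE.mono (h : ∀ V, 𝒳 V → 𝒳' V) {n : ℕ} {M : ModuleCat.{u} S}
    (hM : ResDimLE 𝒳 n M) : ResDimLE 𝒳' n M := by
  obtain ⟨X, d, ε, hX, h'⟩ := hM
  exact ⟨X, d, ε, fun i hi => h _ (hX i hi), h'⟩

theorem ResDimLE.of_mem (h0 : 𝒳 (ModuleCat.of S PUnit.{u + 1})) {V : ModuleCat.{u} S} (hV : 𝒳 V)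
    (n : ℕ) : ResDimLE 𝒳 n V := by
  let X : ℕ → ModuleCat.{u} S := fun i => Nat.casesOn i V fun _ => ModuleCat.of S PUnit.{u + 1}
  have hs : ∀ i, Subsingleton (X (i + 1)) := fun i => inferInstanceAs (Subsingleton PUnit)
  refine ⟨X, fun i => 0, (LinearMap.id : V →ₗ[S] V), fun i _ => ?_, fun i hi => ?_, fun i x => ?_,
    fun x => ?_, Function.surjective_id⟩
  · cases i with
    | zero => exact hV
    | succ i => exact h0
  · cases i with
    | zero => omega
    | succ i => exact hs i
  · exact ⟨fun _ => ⟨0, Subsingleton.elim _ _⟩, fun _ => rfl⟩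
  · constructor
    · intro hx
      exact ⟨0, hx.symm⟩
    · rintro ⟨y, rfl⟩
      rfl

variable (C 𝒳 𝒴) in
/-- There is a short exact sequence `0 → A → V → B → 0`, exact under `Hom(C, -)`, with `V` in
`𝒳` or in `𝒴`. -/
def HomExactStep (A B : ModuleCat.{u} S) : Prop :=
  ∃ (V : ModuleCat.{u} S) (f : A →ₗ[S] V) (g : V →ₗ[S] B), IsSES f g ∧
    (∀ φ : C →ₗ[S] B, ∃ ψ : C →ₗ[S] V, g ∘ₗ ψ = φ) ∧ (𝒳 V ∨ 𝒴 V)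

theorem isCokerOfHomExact_of_chain {Z : ℤ → ModuleCat.{u} S}
    (h : ∀ i, HomExactStep C 𝒳 𝒴 (Z (i + 1)) (Z i)) : IsCokerOfHomExact C 𝒳 𝒴 (Z 0) := by
  choose V f g hS hl hV using h
  refine ⟨V, fun i => f i ∘ₗ g (i + 1), fun i x => ?_, fun i φ => ?_, hV, ?_⟩
  · change f i (g (i + 1) x) = 0 ↔ ∃ y, f (i + 1) (g (i + 1 + 1) y) = x
    rw [map_eq_zero_iff _ (hS i).injective, (hS (i + 1)).exact x]
    constructor
    · rintro ⟨y, rfl⟩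
      obtain ⟨z, rfl⟩ := (hS (i + 1 + 1)).surjective y
      exact ⟨z, rfl⟩
    · rintro ⟨y, rfl⟩
      exact ⟨_, rfl⟩
  · constructor
    · intro hφ
      have hφ' : ∀ c, φ c ∈ LinearMap.range (f (i + 1)) := fun c =>
        ((hS (i + 1)).exact _).1 ((hS i).injective
          ((LinearMap.congr_fun hφ c).trans (map_zero (f i)).symm))
      obtain ⟨ψ, hψ⟩ := hl (i + 1 + 1)
        ((LinearEquiv.ofInjective _ (hS (i + 1)).injective).symm.toLinearMap ∘ₗ
          φ.codRestrict _ hφ')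
      refine ⟨ψ, LinearMap.ext fun c => ?_⟩
      have := LinearMap.congr_fun hψ c
      change f (i + 1) (g (i + 1 + 1) (ψ c)) = φ c
      rw [LinearMap.comp_apply] at this
      rw [this]
      exact congrArg Subtype.val
        ((LinearEquiv.ofInjective _ (hS (i + 1)).injective).apply_symm_apply ⟨φ c, hφ' c⟩)
    · rintro ⟨ψ, rfl⟩
      refine LinearMap.ext fun c => ?_
      change f i (g (i + 1) (f (i + 1) (g (i + 1 + 1) (ψ c)))) = 0
      rw [(hS (i + 1)).exact.apply_apply_eq_zero, map_zero]
  · refine ⟨((Submodule.quotEquivOfEq _ _ ?_).trans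
      ((g 0).quotKerEquivOfSurjective (hS 0).surjective)).symm⟩
    rw [(hS 0).exact.linearMap_ker_eq]
    exact LinearMap.range_comp_of_range_eq_top _
      (LinearMap.range_eq_top.2 (hS (0 + 1)).surjective)

theorem isCokerOfHomExact_of_steps (𝒦 : ModuleCat.{u} S → Prop)
    (left : ∀ A, 𝒦 A → ∃ A', 𝒦 A' ∧ HomExactStep C 𝒳 𝒴 A' A)
    (right : ∀ A, 𝒦 A → ∃ A', 𝒦 A' ∧ HomExactStep C 𝒳 𝒴 A A') {N : ModuleCat.{u} S}
    (hN : 𝒦 N) : IsCokerOfHomExact C 𝒳 𝒴 N := by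
  choose l hl hl' using fun A : {A // 𝒦 A} => left A A.2
  choose r hr hr' using fun A : {A // 𝒦 A} => right A A.2
  let l' : {A // 𝒦 A} → {A // 𝒦 A} := fun A => ⟨l A, hl A⟩
  let r' : {A // 𝒦 A} → {A // 𝒦 A} := fun A => ⟨r A, hr A⟩
  -- Kernels are iterated in degrees ≥ 0 and cokernels in negative degrees; `Int.negSucc k` is -(k +
  -- 1), hence the exponent k + 1.
  let Z : ℤ → {A // 𝒦 A} := fun i =>
    Int.casesOn i (fun k => l'^[k] ⟨N, hN⟩) (fun k => r'^[k + 1] ⟨N, hN⟩)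
  refine isCokerOfHomExact_of_chain (Z := fun i => (Z i).1) fun i => ?_
  rcases i with k | k
  · have : Z (Int.ofNat k + 1) = l' (Z (Int.ofNat k)) := Function.iterate_succ_apply' l' k _
    rw [this]
    exact hl' _
  · have : Z (Int.negSucc k) = r' (Z (Int.negSucc k + 1)) := by
      cases k with
      | zero => rfl
      | succ k => exact Function.iterate_succ_apply' r' (k + 1) _
    rw [this]
    exact hr' _

end Splicing

/-! ### Comparison of the classes, and the two nontrivial implications -/

section Bass

set_option linter.unusedSectionVars false

variable {R S : Type u} [Ring R] [Ring S] {C : Type u} [AddCommGroup C] [Module S C]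
  [Module Rᵐᵒᵖ C] [SMulCommClass S Rᵐᵒᵖ C]

theorem isFlat_of_projective {P : ModuleCat.{u} R} (h : Module.Projective R P) : IsFlat P :=
  fun _ _ _ hf => rTensor_injective_of_projective hf

/-- Tor₁(X, F) is computed from a finite free presentation of X, where flatness preserves the
inclusion of the kernel. -/
theorem IsFlat.isWeakFlat {F : ModuleCat.{u} R} (h : IsFlat F) : IsWeakFlat F := by
  intro X hX
  obtain ⟨n, p, hp, -⟩ := hX.syzygyFP.exists_free
  exact subsingleton_tor_one (IsSES.ker hp) (h (ModuleCat.of Rᵐᵒᵖ (LinearMap.ker p))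
    (ModuleCat.of Rᵐᵒᵖ (Fin n → Rᵐᵒᵖ)) _ (Submodule.injective_subtype _))

theorem IsCProjective.isCFlat {V : ModuleCat.{u} S} (h : IsCProjective R C V) : IsCFlat R C V := by
  obtain ⟨P, hP, e⟩ := h
  exact ⟨P, isFlat_of_projective hP, e⟩

theorem IsCFlat.isCWeakFlat {V : ModuleCat.{u} S} (h : IsCFlat R C V) : IsCWeakFlat R C V := by
  obtain ⟨P, hP, e⟩ := h
  exact ⟨P, hP.isWeakFlat, e⟩

theorem isCProjective_punit : IsCProjective R C (ModuleCat.of S PUnit.{u + 1}) := by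
  have : Subsingleton (BTensor S R C PUnit.{u + 1}) := subsingleton_of_forall_eq 0 fun z => by
    induction z using BTensor.induction with
    | zero => rfl
    | tmul c x => exact BTensor.tmul_zero c
    | add a b ha hb => rw [ha, hb, add_zero]
  exact ⟨ModuleCat.of R PUnit.{u + 1}, inferInstanceAs (Module.Projective R PUnit.{u + 1}),
    ⟨LinearEquiv.ofSubsingleton _ _⟩⟩

theorem InjDimLE.fpInjDimLE {n : ℕ} {V : ModuleCat.{u} S} (h : InjDimLE n V) : FPInjDimLE n V :=
  ⟨n, le_rfl, fun _ _ => extVanish_of_injDimLE h (Nat.lt_succ_self n)⟩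

theorem FPInjDimLE.weakInjDimLE {n : ℕ} {V : ModuleCat.{u} S} (h : FPInjDimLE n V) :
    WeakInjDimLE n V := by
  obtain ⟨m, hm, h⟩ := h
  exact ⟨m, hm, fun F hF => h F hF.syzygyFP.finitePresentation⟩

theorem InjDimLE.mono {n : ℕ} {V : ModuleCat.{u} S} (h : InjDimLE 0 V) : InjDimLE n V := by
  have : HasInjectiveDimensionLT V 1 := h
  exact hasInjectiveDimensionLT_of_ge V 1 (n + 1) (by omega)

theorem InBassClass.exists_left_step (hC : IsSemidualizing R S C) (n : ℕ) {N : ModuleCat.{u} S}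
    (hN : InBassClass R C N) : ∃ N' : ModuleCat.{u} S, InBassClass R C N' ∧
      HomExactStep C (InjDimLE n) (ResDimLE (IsCProjective R C) n) N' N := by
  let P := ModuleCat.of R (BHom R S C N →₀ R)
  have hP : Module.Projective R P := inferInstanceAs (Module.Projective R (BHom R S C N →₀ R))
  let p : P →ₗ[R] BHom R S C N := Finsupp.linearCombination R id
  have hp : Function.Surjective p := Finsupp.linearCombination_id_surjective R _
  let g : BTensor S R C P →ₗ[S] N := evalMap R S C N ∘ₗ BTensor.lTensor S C p
  have hg : Function.Surjective g :=
    hN.eval_bijective.2.comp (BTensor.lTensor_surjective hp)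
  have hl : ∀ φ : C →ₗ[S] N, ∃ ψ : C →ₗ[S] BTensor S R C P, g ∘ₗ ψ = φ := by
    intro φ
    obtain ⟨x, hx⟩ := hp (BHom.of R φ)
    -- If x maps to φ in Hom_S(C,N), then c ↦ c ⊗ x lifts φ, since evaluation sends c ⊗ φ to φ(c).
    exact ⟨tmulRight R S C x, LinearMap.ext fun c => congr(($hx).hom c)⟩
  have hV : IsCProjective R C (ModuleCat.of S (BTensor S R C P)) :=
    ⟨P, hP, ⟨LinearEquiv.refl S _⟩⟩
  exact ⟨ModuleCat.of S (LinearMap.ker g),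
    InBassClass.left (IsSES.ker hg) hC (hV.isCFlat.isCWeakFlat.inBassClass hC) hN hl,
    ModuleCat.of S (BTensor S R C P), _, g, IsSES.ker hg, hl,
    Or.inr (ResDimLE.of_mem isCProjective_punit hV n)⟩

theorem InBassClass.exists_right_step (hC : IsSemidualizing R S C) (n : ℕ) {N : ModuleCat.{u} S}
    (hN : InBassClass R C N) : ∃ N' : ModuleCat.{u} S, InBassClass R C N' ∧
      HomExactStep C (InjDimLE n) (ResDimLE (IsCProjective R C) n) N N' := by
  obtain ⟨I, i, hI, hi⟩ := exists_injective_embedding N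
  have hIB : InBassClass R C I := hC.inBassClass_of_weakInjective fun F _ =>
    extVanish_of_injDimLE hI one_pos
  exact ⟨ModuleCat.of S (I ⧸ LinearMap.range i), InBassClass.right hi hC hN hIB, I, i, _, hi,
    hi.exists_lift (ModuleCat.of S C) (hN.ext_vanish 1 le_rfl), Or.inl hI.mono⟩

/-- The images of the differentials form a family of cycles to which `inBassClass_of_family`
applies, and N is the quotient of V₀ by one of them. -/
theorem inBassClass_of_isCokerOfHomExact (hC : IsSemidualizing R S C)
    {𝒳 𝒴 : ModuleCat.{u} S → Prop} (hX : ∀ V, 𝒳 V → InBassClass R C V)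
    (hY : ∀ V, 𝒴 V → InBassClass R C V) {N : ModuleCat.{u} S} (h : IsCokerOfHomExact C 𝒳 𝒴 N) :
    InBassClass R C N := by
  obtain ⟨V, d, hd, hHom, hV, ⟨e⟩⟩ := h
  have hVB : ∀ i, InBassClass R C (V i) := fun i => (hV i).elim (hX _) (hY _)
  have key : ∀ k, InBassClass R C (ModuleCat.of S (LinearMap.range (d (k + 1)))) := by
    refine inBassClass_of_family hC (V := fun k => V (k + 1 + 1))
      (f := fun k => (LinearMap.range (d (k + 1 + 1))).subtype)
      (g := fun k => (d (k + 1)).rangeRestrict) (fun k => ⟨Submodule.injective_subtype _, ?_,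
        LinearMap.surjective_rangeRestrict _⟩) (fun k φ => ?_) (fun k => hVB _)
    · rw [LinearMap.exact_iff, LinearMap.ker_rangeRestrict, (hd (k + 1)).linearMap_ker_eq,
        Submodule.range_subtype]
    -- Viewed as a map into V_{k+1}, φ is killed by d_k, so exactness under Hom_S(C, -) lifts it to
    -- V_{k+2}.
    · obtain ⟨ψ, hψ⟩ := (hHom k ((LinearMap.range (d (k + 1))).subtype ∘ₗ φ)).1 (by
        refine LinearMap.ext fun c => ?_
        obtain ⟨y, hy⟩ := (φ c).2
        change d k (φ c).1 = 0
        rw [← hy, (hd k).apply_apply_eq_zero])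
      exact ⟨ψ, LinearMap.ext fun c => Subtype.ext (LinearMap.congr_fun hψ c)⟩
  -- Generalizing the index allows k = -1 to be used although -1 + 1 is not literally 0 in the
  -- dependent types.
  have h0 : ∀ k : ℤ, ∀ m, k + 1 = m →
      InBassClass R C (ModuleCat.of S (LinearMap.range (d m))) := by
    rintro k _ rfl
    exact key k
  have hS : IsSES (LinearMap.range (d 0)).subtype (LinearMap.range (d 0)).mkQ :=
    ⟨Submodule.injective_subtype _, LinearMap.exact_subtype_mkQ _, Submodule.mkQ_surjective _⟩
  exact (InBassClass.right hS hC (h0 (-1) 0 (by norm_num)) (hVB 0)).of_equiv hC e.symm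

end Bass

end Foxby

end


theorem corollary4p10 {R S : Type u} [Ring R] [Ring S] (C : Type u) [AddCommGroup C]
    [Module S C] [Module Rᵐᵒᵖ C] [SMulCommClass S Rᵐᵒᵖ C]
    (hC : Foxby.IsFaithfullySemidualizing R S C) (n : ℕ) (N : ModuleCat.{u} S) :
    List.TFAE [
      Foxby.InBassClass R C N,
      Foxby.IsCokerOfHomExact C (Foxby.InjDimLE n)
        (Foxby.ResDimLE (Foxby.IsCProjective R C) n) N,
      Foxby.IsCokerOfHomExact C (Foxby.InjDimLE n)
        (Foxby.ResDimLE (Foxby.IsCFlat R C) n) N,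
      Foxby.IsCokerOfHomExact C (Foxby.FPInjDimLE n)
        (Foxby.ResDimLE (Foxby.IsCFlat R C) n) N,
      Foxby.IsCokerOfHomExact C (Foxby.WeakInjDimLE n)
        (Foxby.ResDimLE (Foxby.IsCWeakFlat R C) n) N] := by
  have hC' := hC.toIsSemidualizing
  tfae_have 1 → 2 := fun h => Foxby.isCokerOfHomExact_of_steps (Foxby.InBassClass R C)
    (fun _ hA => hA.exists_left_step hC' n) (fun _ hA => hA.exists_right_step hC' n) h
  tfae_have 2 → 3 := fun h => h.mono (fun _ hV => hV)
    fun _ hV => hV.mono fun _ hX => hX.isCFlat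
  tfae_have 3 → 4 := fun h => h.mono (fun _ hV => hV.fpInjDimLE) fun _ hV => hV
  tfae_have 4 → 5 := fun h => h.mono (fun _ hV => hV.weakInjDimLE)
    fun _ hV => hV.mono fun _ hX => hX.isCWeakFlat
  tfae_have 5 → 1 := fun h => Foxby.inBassClass_of_isCokerOfHomExact hC'
    (fun V hV => by
      obtain ⟨m, -, hm⟩ := hV
      exact hC.inBassClass_of_weakInjDim m V fun F hF => hm F hF.isSuperFP)
    (fun V hV => Foxby.inBassClass_of_resDimLE hC' (fun _ hX => hX.inBassClass hC') n V hV) h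
  tfae_finish
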